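/- Let $\mathsf{Rng}$ be the category of (associative, not necessarily unitary) rings, $\mathsf{CRng}$ its full subcategory of commutative rings, and $\mathsf{RedCRng}$ the full subcategory of $\mathsf{CRng}$ of reduced rings (those with $x^n=0,\ n\ge 1\Rightarrow x=0$). Let $I\colon\mathsf{Rng}\to\mathsf{CRng}$ and $F\colon\mathsf{CRng}\to\mathsf{RedCRng}$ be the reflectors (left adjoints of the inclusions). Consider the composite reflection $F\circ I\colon \mathsf{Rng}\to\mathsf{RedCRng}$, with unit $\eta$, together with the class of regular epimorphisms of $\mathsf{Rng}$. Terminology. A monadic extension is a regular epimorphism $p\colon E\to B$ such that pulling back along $p$ defines a monadic functor from regular epimorphisms over $B$ to regular epimorphisms over $E$. A regular epimorphism $f\colon A\to B$ is a trivial extension if its naturality square for $\eta$ is a pullback; a monadic extension $f$ is a normal extension if the first projection of its kernel pair is a trivial extension. A normal extension $p\colon E\to B$ is weakly universal if for every normal extension $p'\colon E'\to B$ there is $u\colon E\to E'$ with $p=p'u$. Its Galois group is the kernel of $\langle FI(\pi_1),FI(\pi_2)\rangle\colon FI(E\times_BE)\to FI(E)\times FI(E)$, where $\pi_1,\pi_2$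 are the projections of the kernel pair of $p$; when $p$ is weakly universal, it is called the fundamental group $\pi_1(B)$. For a reflective subcategory $\mathcal X$ of $\mathsf{Rng}$ or of $\mathsf{CRng}$, the homological closure $\overline{J}^{\mathcal X}_A$ of an ideal $J$ of $A$ is the inverse image along $A\to A/J$ of the kernel of the unit of the reflection at $A/J$. For $f\colon A\to B$ in $\mathsf{Rng}$ with kernel $K$ and kernel pair $(\pi_1,\pi_2)\colon R\rightrightarrows A$, the relative commutator $[K,A]_{\mathsf{CRng}}$ is the image under $\pi_2$ of the set of elements of $R$ that are killed both by $\pi_1$ and by the unit $R\to I(R)$. All ideals of non-commutative rings are two-sided. Then: (1) The Galois structure given by $F\circ I$ and the regular epimorphisms is admissible: for every $B$ in $\mathsf{Rng}$ and every surjective $\varphi\colon X\to FI(B)$ with $X$ in $\mathsf{RedCRng}$, the second projection $B\times_{FI(B)}X\to X$ induces an isomorphism $FI(B\times_{FI(B)}X)\cong X$. The functor $F$ is protoadditive, i.e. it preserves split short exact sequences. (2) For every ideal $J$ of a commutative ring $A$, the homological closure of $J$ for the reflection $F\colon\mathsf{CRng}\to\mathsf{RedCRng}$ is its radical: $\overline{J}^{\mathsf{RedCRng}}_A=\sqrt{J}_{(A)}=\{a\in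 A\mid a^n\in J\text{ for some }n\ge1\}$. (3) Let $0\to K\to P\xrightarrow{f} B\to 0$ be a free presentation of a ring $B$, i.e. $P$ is a free ring, $f$ is a regular epimorphism and $K$ is its kernel. Then $[P,P]_{\mathsf{CRng}}$ (the relative commutator of $P\to 0$) is the ideal of $P$ generated by the elements $pp'-p'p$ with $p,p'\in P$, and $[K,P]_{\mathsf{CRng}}$ (that of $f$) is the ideal of $P$ generated by the elements $pk-kp$ with $k\in K$, $p\in P$. Their closures for the reflection $\mathsf{Rng}\to\mathsf{RedCRng}$, the first in $P$ and the second in $K$, are the radicals $$\sqrt{[P,P]_{\mathsf{CRng}}}_{(P)}=\{p\in P\mid p^n\in[P,P]_{\mathsf{CRng}}\text{ for some }n\ge1\},\qquad \sqrt{[K,P]_{\mathsf{CRng}}}_{(K)}=\{k\in K\mid k^n\in[K,P]_{\mathsf{CRng}}\text{ for some }n\ge1\},$$ which are ideals of $P$ and of $K$ respectively, and the second is contained in the first. Weakly universal normal extensions of $B$ exist, and for each of them the Galois group is isomorphic, as a ring, to the quotient below; that is, $$\pi_1(B)\cong\frac{K\wedge\sqrt{[P,P]_{\mathsf{CRng}}}_{(P)}}{\sqrt{[K,P]_{\mathsf{CRng}}}_{(K)}}.$$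 -/

import Mathlib

open CategoryTheory CategoryTheory.Limits

universe v₁ v₂ u₁ u₂ u

/-! ### Galois structures -/

/-- A Galois structure: a (full) reflective subcategory `H : ℬ ⥤ 𝒜` together with a class `ℰ` of
morphisms of `𝒜`, preserved by the reflection, along which pullbacks exist, which is closed under
composition, contains the isomorphisms and is stable under pullback. -/
structure GaloisStructure (𝒜 : Type u₁) (ℬ : Type u₂) [Category.{v₁} 𝒜] [Category.{v₂} ℬ] where
  /-- the inclusion functor -/
  H : ℬ ⥤ 𝒜
  /-- full faithfulness of the inclusion, the left adjoint `I` and the adjunction -/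
  reflective : Reflective H
  /-- the class of extensions -/
  ℰ : MorphismProperty 𝒜
  map_mem : ∀ {X Y : 𝒜} (f : X ⟶ Y), ℰ f → ℰ (H.map ((reflector H).map f))
  hasPullback : ∀ {X Y Z : 𝒜} (f : X ⟶ Z) (g : Y ⟶ Z), ℰ f → HasPullback f g
  comp_mem : ℰ.IsStableUnderComposition
  iso_mem : ∀ {X Y : 𝒜} (f : X ⟶ Y), IsIso f → ℰ f
  pullback_mem : ℰ.IsStableUnderBaseChange

namespace GaloisStructure

attribute [instance] GaloisStructure.reflective GaloisStructure.comp_mem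
  GaloisStructure.pullback_mem

variable {𝒜 : Type u₁} {ℬ : Type u₂} [Category.{v₁} 𝒜] [Category.{v₂} ℬ]
  (Γ : GaloisStructure 𝒜 ℬ)

instance {X Y : 𝒜} (p : X ⟶ Y) : Γ.ℰ.HasPullbacksAlong p where
  hasPullback g hg := Γ.hasPullback g p hg

/-- The reflector. -/
abbrev I : 𝒜 ⥤ ℬ := reflector Γ.H

/-- The component of the unit of the reflection at `A`. -/
abbrev η (A : 𝒜) : A ⟶ Γ.H.obj (Γ.I.obj A) := (reflectorAdjunction Γ.H).unit.app A

/-- Admissibility: for every `B` in `𝒜` and every `(X, φ)` in `ℬ ↓ I B`, the component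
`I (B ×_{HI B} H X) ⟶ I (H X) ⟶ X` of the counit of the adjunction `I^B ⊣ H^B` is an
isomorphism. -/
def Admissible : Prop :=
  ∀ (B : 𝒜) (X : ℬ) (φ : X ⟶ Γ.I.obj B), Γ.ℰ (Γ.H.map φ) →
    ∀ (Q : 𝒜) (π₁ : Q ⟶ B) (π₂ : Q ⟶ Γ.H.obj X), IsPullback π₁ π₂ (Γ.η B) (Γ.H.map φ) →
      IsIso (Γ.I.map π₂ ≫ (reflectorAdjunction Γ.H).counit.app X)

/-- Monadic extensions: arrows `p : E ⟶ B` in `ℰ` for which the pullback functor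
`p^* : 𝒜 ↓ B ⥤ 𝒜 ↓ E` between the categories of extensions (full subcategories of the slice
categories) is monadic. -/
def IsMonadicExtension {E B : 𝒜} (p : E ⟶ B) : Prop :=
  Γ.ℰ p ∧ Nonempty (MonadicRightAdjoint (MorphismProperty.Over.pullback Γ.ℰ ⊤ p))

/-- Trivial extensions: arrows in `ℰ` whose naturality square for the unit is a pullback. -/
def IsTrivialExtension {E B : 𝒜} (f : E ⟶ B) : Prop :=
  Γ.ℰ f ∧ IsPullback (Γ.η E) f (Γ.H.map (Γ.I.map f)) (Γ.η B)

/-- Normal extensions: monadic extensions `f` such that `f^* f`, the first projection of the kernel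
pair of `f` (which exists because `f` is in `ℰ`), is a trivial extension. -/
def IsNormalExtension {E B : 𝒜} (f : E ⟶ B) : Prop :=
  Γ.IsMonadicExtension f ∧
    ∀ (R : 𝒜) (π₁ π₂ : R ⟶ E), IsPullback π₁ π₂ f f → Γ.IsTrivialExtension π₁

/-- Weakly universal normal extensions of `B`: every normal extension of `B` receives a morphism
over `B` from it. -/
def IsWeaklyUniversalNormalExtension {E B : 𝒜} (p : E ⟶ B) : Prop :=
  Γ.IsNormalExtension p ∧
    ∀ (E' : 𝒜) (p' : E' ⟶ B), Γ.IsNormalExtension p' → ∃ w : E ⟶ E', p = w ≫ p'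

/-- The (underlying object of the) Galois group `Gal (E, p, 0)`: the pullback of
`⟨I π₁, I π₂⟩ : I (E ×_B E) ⟶ I E × I E` along `0 ⟶ I E × I E`. -/
noncomputable def galoisGroup [HasPullbacks 𝒜] [HasPullbacks ℬ] [HasBinaryProducts ℬ]
    [HasZeroObject ℬ] {E B : 𝒜} (p : E ⟶ B) : ℬ :=
  pullback
    (prod.lift (Γ.I.map (pullback.fst p p)) (Γ.I.map (pullback.snd p p)))
    ((isZero_zero ℬ).to_ (Γ.I.obj E ⨯ Γ.I.obj E))

end GaloisStructure

/-- Split short exact sequences `K ⟶ A ⇄ B` in a pointed category: `s` is a section of `f`,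
`k` is the kernel of `f` and `f` is the cokernel of `k`. -/
structure IsSplitShortExact {𝒞 : Type u₁} [Category.{v₁} 𝒞] [HasZeroObject 𝒞] {K A B : 𝒞}
    (k : K ⟶ A) (f : A ⟶ B) (s : B ⟶ A) : Prop where
  section_comp : s ≫ f = 𝟙 B
  isKernel : IsPullback k ((isZero_zero 𝒞).from_ K) f ((isZero_zero 𝒞).to_ B)
  isCokernel : IsPushout k ((isZero_zero 𝒞).from_ K) f ((isZero_zero 𝒞).to_ B)

/-- Protoadditive functors: those that preserve split short exact sequences. -/
def Protoadditive {𝒞 : Type u₁} {𝒟 : Type u₂} [Category.{v₁} 𝒞] [Category.{v₂} 𝒟]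
    [HasZeroObject 𝒞] [HasZeroObject 𝒟] (F : 𝒞 ⥤ 𝒟) : Prop :=
  ∀ ⦃K A B : 𝒞⦄ (k : K ⟶ A) (f : A ⟶ B) (s : B ⟶ A),
    IsSplitShortExact k f s → IsSplitShortExact (F.map k) (F.map f) (F.map s)

/-! ### Powers, quotients and radicals in rings without unit -/

section NonUnital

variable {A : Type u₁} {B : Type u₂} [NonUnitalRing A] [NonUnitalRing B]

/-- `ppow x n` is the power `x ^ (n + 1)`; these are all powers of `x` with positive exponent. -/
def ppow (x : A) : ℕ → A
  | 0 => x
  | n + 1 => ppow x n * x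

theorem map_ppow (f : A →ₙ+* B) (x : A) (n : ℕ) : f (ppow x n) = ppow (f x) n := by
  induction n with
  | zero => rfl
  | succ n ih => simp [ppow, ih]

theorem ppow_eq_npow {C : Type u₁} [Ring C] (x : C) (n : ℕ) : ppow x n = x ^ (n + 1) := by
  induction n with
  | zero => simp [ppow]
  | succ n ih => rw [ppow, ih, pow_succ x (n + 1)]

namespace TwoSidedIdeal

/-- The quotient `A / J`. -/
abbrev Quo (J : TwoSidedIdeal A) : Type u₁ := J.ringCon.Quotient

/-- The canonical projection `A → A / J`. -/
def quotMk (J : TwoSidedIdeal A) : A →ₙ+* J.Quo where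
  toFun a := (a : J.ringCon.Quotient)
  map_zero' := rfl
  map_add' _ _ := rfl
  map_mul' _ _ := rfl

theorem quotMk_surjective (J : TwoSidedIdeal A) : Function.Surjective J.quotMk :=
  Quotient.mk''_surjective

theorem quotMk_eq_zero (J : TwoSidedIdeal A) (a : A) : J.quotMk a = 0 ↔ a ∈ J := by
  rw [TwoSidedIdeal.mem_iff]
  exact RingCon.eq J.ringCon

/-- The homomorphism `A / J → B` induced by a homomorphism `A → B` that vanishes on `J`. -/
def quotLift (J : TwoSidedIdeal A) (f : A →ₙ+* B) (h : ∀ a ∈ J, f a = 0) : J.Quo →ₙ+* B where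
  toFun := Quotient.lift f fun a b hab => by
    have := h _ ((J.rel_iff a b).1 hab)
    rwa [map_sub, sub_eq_zero] at this
  map_zero' := map_zero f
  map_add' x y := by
    induction x using Quotient.inductionOn
    induction y using Quotient.inductionOn
    exact map_add f _ _
  map_mul' x y := by
    induction x using Quotient.inductionOn
    induction y using Quotient.inductionOn
    exact map_mul f _ _

@[simp]
theorem quotLift_quotMk (J : TwoSidedIdeal A) (f : A →ₙ+* B) (h : ∀ a ∈ J, f a = 0) (a : A) :
    J.quotLift f h (J.quotMk a) = f a := rfl

theorem quot_hom_ext (J : TwoSidedIdeal A) {f g : J.Quo →ₙ+* B}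
    (h : ∀ a, f (J.quotMk a) = g (J.quotMk a)) : f = g := by
  ext x
  obtain ⟨a, rfl⟩ := J.quotMk_surjective x
  exact h a

theorem quot_comm (J : TwoSidedIdeal A) (hJ : ∀ x y : A, x * y - y * x ∈ J) (x y : J.Quo) :
    x * y = y * x := by
  obtain ⟨a, rfl⟩ := J.quotMk_surjective x
  obtain ⟨b, rfl⟩ := J.quotMk_surjective y
  rw [← sub_eq_zero, ← map_mul, ← map_mul, ← map_sub, quotMk_eq_zero]
  exact hJ a b

theorem exists_commRing_hom (J : TwoSidedIdeal A) (hJ : ∀ x y : A, x * y - y * x ∈ J) :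
    ∃ (R : Type u₁) (_ : CommRing R) (g : A →ₙ+* R), ∀ a, g a = 0 ↔ a ∈ J := by
  let _ : NonUnitalCommRing J.Quo := { mul_comm := J.quot_comm hJ }
  refine ⟨Unitization ℤ J.Quo, inferInstance,
    (Unitization.inrNonUnitalAlgHom ℤ J.Quo : J.Quo →ₙ+* Unitization ℤ J.Quo).comp J.quotMk,
    fun a => ?_⟩
  rw [← quotMk_eq_zero]
  exact ⟨fun h => Unitization.inr_injective (R := ℤ) h, fun h => congrArg Unitization.inr h⟩

theorem exists_ppow_mem_iff {J : TwoSidedIdeal A} {R : Type u₂} [CommRing R] {g : A →ₙ+* R}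
    (hg : ∀ a, g a = 0 ↔ a ∈ J) (a : A) : (∃ n, ppow a n ∈ J) ↔ IsNilpotent (g a) := by
  constructor
  · rintro ⟨n, hn⟩
    exact ⟨n + 1, by rw [← ppow_eq_npow, ← map_ppow]; exact (hg _).2 hn⟩
  · rintro ⟨n, hn⟩
    exact ⟨n, (hg _).1 (by rw [map_ppow, ppow_eq_npow, pow_succ, hn, zero_mul])⟩

/-- The radical `√J = {a | ∃ n ≥ 1, a ^ n ∈ J}` of a two-sided ideal `J` containing all
commutators (every ideal is such if the ring is commutative). -/
def radical (J : TwoSidedIdeal A) (hJ : ∀ x y : A, x * y - y * x ∈ J) : TwoSidedIdeal A :=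
  TwoSidedIdeal.mk' {a | ∃ n, ppow a n ∈ J}
    ⟨0, J.zero_mem⟩
    (fun {x y} hx hy => by
      obtain ⟨R, _, g, hg⟩ := exists_commRing_hom J hJ
      have key := exists_ppow_mem_iff hg
      refine (key (x + y)).2 ?_
      rw [map_add]
      exact (Commute.all _ _).isNilpotent_add ((key x).1 hx) ((key y).1 hy))
    (fun {x} hx => by
      obtain ⟨R, _, g, hg⟩ := exists_commRing_hom J hJ
      have key := exists_ppow_mem_iff hg
      refine (key (-x)).2 ?_
      rw [map_neg]
      exact ((key x).1 hx).neg)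
    (fun {x y} hy => by
      obtain ⟨R, _, g, hg⟩ := exists_commRing_hom J hJ
      have key := exists_ppow_mem_iff hg
      refine (key (x * y)).2 ?_
      rw [map_mul]
      exact (Commute.all _ _).isNilpotent_mul_left ((key y).1 hy))
    (fun {x y} hx => by
      obtain ⟨R, _, g, hg⟩ := exists_commRing_hom J hJ
      have key := exists_ppow_mem_iff hg
      refine (key (x * y)).2 ?_
      rw [map_mul]
      exact (Commute.all _ _).isNilpotent_mul_right ((key x).1 hx))

theorem mem_radical (J : TwoSidedIdeal A) (hJ : ∀ x y : A, x * y - y * x ∈ J) (a : A) :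
    a ∈ J.radical hJ ↔ ∃ n, ppow a n ∈ J :=
  TwoSidedIdeal.mem_mk' _ _ _ _ _ _ _

/-- `[A, A]`, the two-sided ideal of `A` generated by the elements `x y - y x`. -/
def commutatorIdeal (A : Type u₁) [NonUnitalRing A] : TwoSidedIdeal A :=
  TwoSidedIdeal.span {z | ∃ x y : A, z = x * y - y * x}

theorem commutator_mem (x y : A) : x * y - y * x ∈ commutatorIdeal A :=
  TwoSidedIdeal.subset_span ⟨x, y, rfl⟩

/-- `[K, A]`, the two-sided ideal of `A` generated by the elements `a k - k a` with `k ∈ K` and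
`a ∈ A`. -/
def commutatorWith (K : TwoSidedIdeal A) : TwoSidedIdeal A :=
  TwoSidedIdeal.span {z | ∃ k ∈ K, ∃ a : A, z = a * k - k * a}

/-- The two-sided ideal `K` regarded as a ring, with its inclusion into `A`. -/
def incl (K : TwoSidedIdeal A) : K →ₙ+* A := NonUnitalSubringClass.subtype K

/-- `[K, A]` regarded as an ideal of `K` (it is contained in `K`). -/
def commutatorIn (K : TwoSidedIdeal A) : TwoSidedIdeal K :=
  TwoSidedIdeal.comap K.incl K.commutatorWith

theorem commutatorIn_mem (K : TwoSidedIdeal A) (x y : K) : x * y - y * x ∈ K.commutatorIn :=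
  (TwoSidedIdeal.mem_comap K.incl).2 (TwoSidedIdeal.subset_span ⟨y, y.2, x, rfl⟩)

/-- The inclusion of an ideal into a larger one. -/
def inclOfLE {I J : TwoSidedIdeal A} (h : I ≤ J) : I →ₙ+* J where
  toFun x := ⟨x, h x.2⟩
  map_zero' := rfl
  map_add' _ _ := rfl
  map_mul' _ _ := rfl

end TwoSidedIdeal

end NonUnital

/-! ### The category of rings without unit -/

/-- The category `Rng` of (not necessarily unitary, associative) rings. -/
structure Rng where
  of ::
  /-- the underlying type -/
  carrier : Type u
  [ring : NonUnitalRing carrier]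

namespace Rng

attribute [instance] Rng.ring

instance : CoeSort Rng.{u} (Type u) := ⟨Rng.carrier⟩

/-- Morphisms of `Rng`: additive and multiplicative maps. -/
@[ext]
structure Hom (A B : Rng.{u}) where
  hom' : A →ₙ+* B

instance : Category Rng.{u} where
  Hom A B := Hom A B
  id A := ⟨NonUnitalRingHom.id A⟩
  comp f g := ⟨g.hom'.comp f.hom'⟩

instance : ConcreteCategory.{u} Rng.{u} (fun A B => A →ₙ+* B) where
  hom := Hom.hom'
  ofHom f := ⟨f⟩

/-- The ring homomorphism underlying a morphism of `Rng`. -/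
abbrev Hom.hom {A B : Rng.{u}} (f : Hom A B) : A →ₙ+* B := ConcreteCategory.hom (C := Rng) f

/-- The morphism of `Rng` given by a ring homomorphism. -/
abbrev ofHom {A B : Type u} [NonUnitalRing A] [NonUnitalRing B] (f : A →ₙ+* B) : of A ⟶ of B :=
  ConcreteCategory.ofHom (C := Rng) f

@[ext]
theorem hom_ext {A B : Rng.{u}} {f g : A ⟶ B} (h : f.hom = g.hom) : f = g := Hom.ext h

theorem elem_ext {A B : Rng.{u}} {f g : A ⟶ B} (h : ∀ a : A, f.hom a = g.hom a) : f = g :=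
  hom_ext (NonUnitalRingHom.ext h)

theorem congr_elem {A B : Rng.{u}} {f g : A ⟶ B} (h : f = g) (a : A) : f.hom a = g.hom a := by
  rw [h]

theorem isZero_of_subsingleton (A : Rng.{u}) [Subsingleton A] : IsZero A where
  unique_to B := ⟨⟨⟨⟨0⟩⟩, fun f => elem_ext fun a => by
    rw [Subsingleton.elim a 0, map_zero, map_zero]⟩⟩
  unique_from B := ⟨⟨⟨⟨0⟩⟩, fun _ => elem_ext fun _ => Subsingleton.elim _ _⟩⟩

instance : HasZeroObject Rng.{u} := ⟨of PUnit, isZero_of_subsingleton (of PUnit)⟩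

section Pullback

variable {A B C : Rng.{u}} (f : A ⟶ C) (g : B ⟶ C)

/-- The fibre product of two homomorphisms. -/
def fibreProduct : NonUnitalSubring (A × B) where
  carrier := {x | f.hom x.1 = g.hom x.2}
  zero_mem' := by simp
  add_mem' := by
    intro x y hx hy
    simp only [Set.mem_ofPred_eq] at hx hy
    simp [hx, hy]
  neg_mem' := by
    intro x hx
    simp only [Set.mem_ofPred_eq] at hx
    simp [hx]
  mul_mem' := by
    intro x y hx hy
    simp only [Set.mem_ofPred_eq] at hx hy
    simp [hx, hy]

/-- The first projection of the fibre product. -/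
def fibreFst : of (fibreProduct f g) ⟶ A :=
  ofHom ((NonUnitalRingHom.fst A B).comp (NonUnitalSubringClass.subtype (fibreProduct f g)))

/-- The second projection of the fibre product. -/
def fibreSnd : of (fibreProduct f g) ⟶ B :=
  ofHom ((NonUnitalRingHom.snd A B).comp (NonUnitalSubringClass.subtype (fibreProduct f g)))

theorem isPullback_fibreProduct : IsPullback (fibreFst f g) (fibreSnd f g) f g where
  w := elem_ext fun x => x.2
  isLimit' := ⟨PullbackCone.IsLimit.mk _
    (fun s => ofHom (B := fibreProduct f g)
      { toFun := fun x => ⟨(s.fst.hom x, s.snd.hom x), congr_elem s.condition x⟩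
        map_zero' := Subtype.ext (Prod.ext (map_zero _) (map_zero _))
        map_add' := fun x y => Subtype.ext (Prod.ext (map_add _ x y) (map_add _ x y))
        map_mul' := fun x y => Subtype.ext (Prod.ext (map_mul _ x y) (map_mul _ x y)) })
    (fun _ => rfl) (fun _ => rfl)
    (fun _ _ h₁ h₂ => elem_ext fun x =>
      Subtype.ext (Prod.ext (congr_elem h₁ x) (congr_elem h₂ x)))⟩

end Pullback

instance : HasPullbacks Rng.{u} :=
  haveI : ∀ {A B C : Rng.{u}} {f : A ⟶ C} {g : B ⟶ C}, HasLimit (cospan f g) :=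
    fun {_ _ _ f g} => (isPullback_fibreProduct f g).hasPullback
  hasPullbacks_of_hasLimit_cospan _

instance : HasFiniteLimits Rng.{u} :=
  haveI : HasTerminal Rng.{u} := HasZeroObject.hasTerminal
  hasFiniteLimits_of_hasTerminal_and_pullbacks

/-- The regular epimorphisms of `Rng` are the surjective homomorphisms. -/
theorem isRegularEpi_iff_surjective {A B : Rng.{u}} (f : A ⟶ B) :
    IsRegularEpi f ↔ Function.Surjective f.hom := by
  constructor
  · rintro ⟨⟨r⟩⟩
    let S := NonUnitalRingHom.range f.hom
    let e : A ⟶ of S := ofHom f.hom.rangeRestrict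
    let i : of S ⟶ B := ofHom (NonUnitalSubringClass.subtype S)
    have hei : e ≫ i = f := rfl
    have hw : r.left ≫ e = r.right ≫ e :=
      elem_ext fun x => Subtype.ext (congr_elem r.w x)
    let d : B ⟶ of S := r.isColimit.desc (Cofork.ofπ e hw)
    have hd : f ≫ d = e := r.isColimit.fac (Cofork.ofπ e hw) WalkingParallelPair.one
    have hid : d ≫ i = 𝟙 B := by
      refine Cofork.IsColimit.hom_ext r.isColimit ?_
      change f ≫ d ≫ i = f ≫ 𝟙 B
      rw [← Category.assoc, hd, hei, Category.comp_id]
    intro b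
    obtain ⟨a, ha⟩ := (d.hom b).2
    exact ⟨a, ha.trans (congr_elem hid b)⟩
  · intro hf
    refine ⟨⟨⟨_, fibreFst f f, fibreSnd f f, (isPullback_fibreProduct f f).w, ?_⟩⟩⟩
    have key : ∀ (s : Cofork (fibreFst f f) (fibreSnd f f)) (a a' : A),
        f.hom a = f.hom a' → s.π.hom a = s.π.hom a' := fun s a a' h =>
      congr_elem s.condition (⟨(a, a'), h⟩ : fibreProduct f f)
    have hinv := Function.surjInv_eq hf
    let d : ∀ s : Cofork (fibreFst f f) (fibreSnd f f), B ⟶ s.pt := fun s =>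
      ⟨{ toFun := fun b => s.π.hom (Function.surjInv hf b)
         map_zero' := (key s _ _ (by rw [hinv, map_zero])).trans (map_zero s.π.hom)
         map_add' := fun x y =>
          (key s _ _ (by simp only [map_add, hinv])).trans (map_add s.π.hom _ _)
         map_mul' := fun x y =>
          (key s _ _ (by simp only [map_mul, hinv])).trans (map_mul s.π.hom _ _) }⟩
    refine Cofork.IsColimit.mk _ d (fun s => ?_) (fun s m hm => ?_)
    · exact elem_ext fun a => key s _ _ (hinv _)
    · refine elem_ext fun b => ?_
      have h := congr_elem hm (Function.surjInv hf b)
      exact (congrArg m.hom (hinv b)).symm.trans h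

instance : (MorphismProperty.regularEpi Rng.{u}).IsStableUnderComposition where
  comp_mem f g hf hg := by
    rw [MorphismProperty.regularEpi_iff, isRegularEpi_iff_surjective] at *
    exact hg.comp hf

instance : (MorphismProperty.regularEpi Rng.{u}).IsStableUnderBaseChange where
  of_isPullback {X Y Y' S f g f' g'} h hg := by
    rw [MorphismProperty.regularEpi_iff, isRegularEpi_iff_surjective] at *
    intro y
    obtain ⟨x, hx⟩ := hg (f.hom y)
    let z : fibreProduct g f := ⟨(x, y), hx⟩
    have hw := (isPullback_fibreProduct g f).w
    exact ⟨(h.lift _ _ hw).hom z, congr_elem (h.lift_snd _ _ hw) z⟩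

end Rng

/-! ### Commutative rings and reduced commutative rings -/

/-- Commutativity, as a property of objects of `Rng`. -/
def Rng.isComm : ObjectProperty Rng.{u} := fun A => ∀ x y : A, x * y = y * x

/-- The full subcategory `CRng` of `Rng` of (not necessarily unitary) commutative rings. -/
abbrev CRng := Rng.isComm.{u}.FullSubcategory

/-- Reducedness: `x ^ n = 0` with `n ≥ 1` implies `x = 0`. -/
def CRng.isReduced : ObjectProperty CRng.{u} :=
  fun A => ∀ (x : A.obj) (n : ℕ), ppow x n = 0 → x = 0

/-- The full subcategory `RedCRng` of `CRng` of reduced commutative rings. -/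
abbrev RedCRng := CRng.isReduced.{u}.FullSubcategory

namespace CRng

/-- The inclusion `H : CRng ⥤ Rng`. -/
abbrev inclusion : CRng.{u} ⥤ Rng.{u} := Rng.isComm.ι

/-- The reflection of a ring in `CRng`: its quotient by the ideal generated by commutators. -/
def reflObj (A : Rng.{u}) : CRng.{u} :=
  ⟨Rng.of (TwoSidedIdeal.commutatorIdeal A).Quo,
    TwoSidedIdeal.quot_comm _ TwoSidedIdeal.commutator_mem⟩

/-- The universal property of the reflection in `CRng`. -/
def reflEquiv (A : Rng.{u}) (C : CRng.{u}) : (reflObj A ⟶ C) ≃ (A ⟶ inclusion.obj C) where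
  toFun g := ⟨g.hom.hom.comp (TwoSidedIdeal.quotMk _)⟩
  invFun f := ObjectProperty.homMk ⟨TwoSidedIdeal.quotLift _ f.hom fun a ha => by
    refine (TwoSidedIdeal.mem_ker (f := f.hom)).1
      ((TwoSidedIdeal.span_le (I := TwoSidedIdeal.ker f.hom)).2 ?_ ha)
    rintro _ ⟨x, y, rfl⟩
    rw [SetLike.mem_coe, TwoSidedIdeal.mem_ker, map_sub, map_mul, map_mul, sub_eq_zero]
    exact C.property _ _⟩
  left_inv g := by
    apply ObjectProperty.hom_ext
    exact Rng.hom_ext (TwoSidedIdeal.quot_hom_ext _ fun a => rfl)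
  right_inv f := rfl

/-- `I : Rng ⥤ CRng`, left adjoint to the inclusion `H`. -/
instance : Reflective inclusion.{u} where
  L := Adjunction.leftAdjointOfEquiv reflEquiv (fun _ _ _ _ _ => rfl)
  adj := Adjunction.adjunctionOfEquivLeft reflEquiv (fun _ _ _ _ _ => rfl)

instance : HasFiniteLimits CRng.{u} where
  out _ _ _ := hasLimitsOfShape_of_reflective inclusion

theorem isZero_of_subsingleton (A : CRng.{u}) [Subsingleton A.obj] : IsZero A where
  unique_to B := ⟨⟨⟨ObjectProperty.homMk ((Rng.isZero_of_subsingleton A.obj).to_ B.obj)⟩, fun _ =>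
    ObjectProperty.hom_ext _ ((Rng.isZero_of_subsingleton A.obj).eq_of_src _ _)⟩⟩
  unique_from B := ⟨⟨⟨ObjectProperty.homMk ((Rng.isZero_of_subsingleton A.obj).from_ B.obj)⟩,
    fun _ => ObjectProperty.hom_ext _ ((Rng.isZero_of_subsingleton A.obj).eq_of_tgt _ _)⟩⟩

instance : HasZeroObject CRng.{u} :=
  ⟨⟨Rng.of PUnit, fun _ _ => rfl⟩, @isZero_of_subsingleton _ (inferInstanceAs (Subsingleton PUnit))⟩

theorem commutator_mem (A : CRng.{u}) (J : TwoSidedIdeal A.obj) (x y : A.obj) :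
    x * y - y * x ∈ J := by
  rw [A.property x y, sub_self]
  exact J.zero_mem

/-- The quotient of a commutative ring by an ideal. -/
def quotient (A : CRng.{u}) (J : TwoSidedIdeal A.obj) : CRng.{u} :=
  ⟨Rng.of J.Quo, J.quot_comm (A.commutator_mem J)⟩

end CRng

namespace RedCRng

/-- The inclusion `U : RedCRng ⥤ CRng`. -/
abbrev inclusion : RedCRng.{u} ⥤ CRng.{u} := CRng.isReduced.ι

theorem ppow_ppow {A : Type u} [NonUnitalRing A] (x : A) (m n : ℕ) :
    ppow (ppow x m) n = ppow x ((m + 1) * (n + 1) - 1) := by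
  have h : ∀ i j, ppow x i * ppow x j = ppow x (i + j + 1) := by
    intro i j
    induction j with
    | zero => rfl
    | succ j ih => rw [ppow, ← mul_assoc, ih]; rfl
  induction n with
  | zero => simp [ppow]
  | succ n ih =>
    rw [ppow, ih, h]
    congr 1
    have : (m + 1) * (n + 1) ≥ 1 := Nat.mul_pos (by omega) (by omega)
    rw [show (m + 1) * (n + 1 + 1) = (m + 1) * (n + 1) + (m + 1) by ring]
    omega

/-- The ideal of nilpotent elements of a commutative ring. -/
def nilradical (A : CRng.{u}) : TwoSidedIdeal A.obj :=
  TwoSidedIdeal.radical ⊥ (A.commutator_mem ⊥)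

theorem mem_nilradical (A : CRng.{u}) (x : A.obj) : x ∈ nilradical A ↔ ∃ n, ppow x n = 0 :=
  TwoSidedIdeal.mem_radical _ _ _

/-- The reflection of a commutative ring in `RedCRng`: its quotient by the ideal of nilpotent
elements. -/
def reflObj (A : CRng.{u}) : RedCRng.{u} :=
  ⟨A.quotient (nilradical A), fun x n hx => by
    change (nilradical A).Quo at x
    obtain ⟨a, rfl⟩ := (nilradical A).quotMk_surjective x
    obtain ⟨m, hm⟩ := (mem_nilradical A _).1 (((nilradical A).quotMk_eq_zero _).1
      ((map_ppow (nilradical A).quotMk a n).trans hx))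
    rw [ppow_ppow] at hm
    exact ((nilradical A).quotMk_eq_zero _).2 ((mem_nilradical A _).2 ⟨_, hm⟩)⟩

/-- The universal property of the reflection in `RedCRng`. -/
def reflEquiv (A : CRng.{u}) (C : RedCRng.{u}) : (reflObj A ⟶ C) ≃ (A ⟶ inclusion.obj C) where
  toFun g := ObjectProperty.homMk ⟨g.hom.hom.hom.comp (nilradical A).quotMk⟩
  invFun f := ObjectProperty.homMk (ObjectProperty.homMk
    ⟨(nilradical A).quotLift f.hom.hom fun a ha => by
      obtain ⟨n, hn⟩ := (mem_nilradical A a).1 ha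
      refine C.property _ n ?_
      refine (map_ppow f.hom.hom a n).symm.trans ?_
      rw [hn, map_zero]⟩)
  left_inv g := by
    apply ObjectProperty.hom_ext
    apply ObjectProperty.hom_ext
    exact Rng.hom_ext (TwoSidedIdeal.quot_hom_ext _ fun a => rfl)
  right_inv f := rfl

/-- `F : CRng ⥤ RedCRng`, left adjoint to the inclusion `U`. -/
instance : Reflective inclusion.{u} where
  L := Adjunction.leftAdjointOfEquiv reflEquiv (fun _ _ _ _ _ => rfl)
  adj := Adjunction.adjunctionOfEquivLeft reflEquiv (fun _ _ _ _ _ => rfl)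

instance : HasFiniteLimits RedCRng.{u} where
  out _ _ _ := hasLimitsOfShape_of_reflective inclusion

instance : HasZeroObject RedCRng.{u} :=
  ⟨⟨⟨Rng.of PUnit, fun _ _ => rfl⟩, fun _ _ _ => rfl⟩, by
    have h : IsZero (⟨Rng.of PUnit, fun _ _ => rfl⟩ : CRng.{u}) :=
      @CRng.isZero_of_subsingleton _ (inferInstanceAs (Subsingleton PUnit))
    exact
    { unique_to := fun B => ⟨⟨⟨ObjectProperty.homMk (h.to_ B.obj)⟩, fun f =>
        ObjectProperty.hom_ext _ (h.eq_of_src _ _)⟩⟩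
      unique_from := fun B => ⟨⟨⟨ObjectProperty.homMk (h.from_ B.obj)⟩, fun f =>
        ObjectProperty.hom_ext _ (h.eq_of_tgt _ _)⟩⟩ }⟩

/-- The composite inclusion `H ∘ U : RedCRng ⥤ Rng`. Its reflector is `F ∘ I`, by composition of
the two adjunctions. -/
abbrev toRng : RedCRng.{u} ⥤ Rng.{u} := inclusion ⋙ CRng.inclusion

theorem unit_surjective (A : Rng.{u}) :
    Function.Surjective ((reflectorAdjunction toRng.{u}).unit.app A).hom := by
  intro x
  obtain ⟨y, rfl⟩ := TwoSidedIdeal.quotMk_surjective _ x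
  obtain ⟨z, rfl⟩ := TwoSidedIdeal.quotMk_surjective _ y
  exact ⟨z, rfl⟩

/-- The Galois structure of the composite reflection `Rng ⥤ CRng ⥤ RedCRng`, with `ℰ` the class of
all regular epimorphisms of `Rng`. -/
def galoisStructure : GaloisStructure Rng.{u} RedCRng.{u} where
  H := toRng
  reflective := inferInstance
  ℰ := MorphismProperty.regularEpi Rng
  map_mem {X Y} f hf := by
    rw [MorphismProperty.regularEpi_iff, Rng.isRegularEpi_iff_surjective] at *
    intro y
    obtain ⟨z, rfl⟩ := unit_surjective Y y
    obtain ⟨x, rfl⟩ := hf z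
    exact ⟨((reflectorAdjunction toRng).unit.app X).hom x,
      (Rng.congr_elem ((reflectorAdjunction toRng).unit.naturality f) x).symm⟩
  hasPullback _ _ _ := inferInstance
  comp_mem := inferInstance
  iso_mem f _ := isRegularEpi_of_regularEpi (RegularEpi.ofIso (asIso f))
  pullback_mem := inferInstance

end RedCRng

/-! ### Closures, relative commutators and free rings -/

/-- The homological closure in `A` of a normal subobject (two-sided ideal) `J`, with respect to a
reflective subcategory of `Rng`: the inverse image along `A ⟶ A / J` of the kernel of the unit of
the reflection at `A / J`. -/
def Rng.closure {ℬ : Type u₂} [Category.{v₂} ℬ] (H : ℬ ⥤ Rng.{u}) [Reflective H] {A : Type u}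
    [NonUnitalRing A] (J : TwoSidedIdeal A) : TwoSidedIdeal A :=
  TwoSidedIdeal.comap J.quotMk
    (TwoSidedIdeal.ker ((reflectorAdjunction H).unit.app (Rng.of J.Quo)).hom)

/-- The homological closure in `A` of an ideal `J`, with respect to a reflective subcategory of
`CRng`. -/
def CRng.closure {ℬ : Type u₂} [Category.{v₂} ℬ] (U : ℬ ⥤ CRng.{u}) [Reflective U] (A : CRng.{u})
    (J : TwoSidedIdeal A.obj) : TwoSidedIdeal A.obj :=
  TwoSidedIdeal.comap J.quotMk
    (TwoSidedIdeal.ker ((reflectorAdjunction U).unit.app (A.quotient J)).hom.hom)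

/-- The relative commutator `[K[f], A]_ℬ` for `f : A ⟶ B`, as a subset of `A`: let `N` be the
kernel of the unit of the reflection in `ℬ` at the kernel pair `R[f]`; the relative commutator is
the kernel of the restriction of the first projection to `N`, embedded in `A` by the second
projection. -/
def Rng.relativeCommutator {ℬ : Type u₂} [Category.{v₂} ℬ] (H : ℬ ⥤ Rng.{u}) [Reflective H]
    {A B : Rng.{u}} (f : A ⟶ B) : Set A :=
  {a | ∃ r : (pullback f f : Rng.{u}), ((reflectorAdjunction H).unit.app (pullback f f)).hom r = 0 ∧
    (pullback.fst f f).hom r = 0 ∧ (pullback.snd f f).hom r = a}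

/-- `P` is a free ring: it has a basis `ι : X → P` such that every map from `X` to a ring extends
uniquely to a homomorphism on `P`. -/
def Rng.IsFree (P : Rng.{u}) : Prop :=
  ∃ (X : Type u) (ι : X → P), ∀ (C : Rng.{u}) (g : X → C), ∃! φ : P ⟶ C, ∀ x, φ.hom (ι x) = g x

namespace Rng

variable {P B : Rng.{u}} (f : P ⟶ B)

/-- The kernel `K` of `f : P ⟶ B`, as an ideal of `P`. -/
abbrev kernelIdeal : TwoSidedIdeal P := TwoSidedIdeal.ker f.hom

/-- The radical `√[P, P]` in `P`. -/
def radicalCommutator (P : Rng.{u}) : TwoSidedIdeal P :=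
  (TwoSidedIdeal.commutatorIdeal P).radical TwoSidedIdeal.commutator_mem

/-- The radical `√[K, P]` in `K`. -/
def kernelRadicalCommutator : TwoSidedIdeal (kernelIdeal f) :=
  (kernelIdeal f).commutatorIn.radical (kernelIdeal f).commutatorIn_mem

/-- The intersection `K ∧ √[P, P]`. -/
def hopfNumerator : TwoSidedIdeal P := kernelIdeal f ⊓ radicalCommutator P

/-- The inclusion of `K ∧ √[P, P]` in `K`. -/
def hopfInclusion : hopfNumerator f →ₙ+* kernelIdeal f :=
  TwoSidedIdeal.inclOfLE inf_le_left

/-- `√[K, P]` regarded as an ideal of `K ∧ √[P, P]` (in which it is contained). -/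
def hopfDenominator : TwoSidedIdeal (hopfNumerator f) :=
  TwoSidedIdeal.comap (hopfInclusion f) (kernelRadicalCommutator f)

/-- The quotient ring `(K ∧ √[P, P]) / √[K, P]`. -/
def hopfQuotient : Rng.{u} := Rng.of (hopfDenominator f).Quo

end Rng

/-! ### Powers and commutator ideals -/

section NonUnital

variable {A : Type u₁} {B : Type u₂} [NonUnitalRing A] [NonUnitalRing B]

/-! Everything rests on one computation. Let `R` be the kernel pair of `p : E ⟶ B` with kernel `K`.
An element `(0, k)` of `R` lies in the commutator ideal of `R` exactly when `k` lies in `[K, E]`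
(`exists_kernelPair_iff`), so it dies in the reduced commutative reflection exactly when some
positive power of `k` lies in `[K, E]` (`unit_kernelPair_eq_zero_iff`). These `k` form an ideal
`√[K, E]` of `E`, because elements of `K` commute with `E` modulo `[K, E]`.

The first projection of `R` is split by the diagonal, so it is a trivial extension as soon as `√[K,
E] = 0`, and only then. All surjections are monadic extensions by Beck's theorem
(`isMonadicExtension`), so normal extensions are the surjections with central and reduced kernel
(`isNormalExtension_iff`). The diagonal also identifies the Galois group of such an extension with
`K ∧ √[E, E]` (`nonempty_galoisGroup_iso`).

For a free presentation `f : P ⟶ B`, the quotient `P / √[K, P]` over `B` is normal, and freeness of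
`P` makes it weakly universal. Its Galois group is the Hopf quotient, since `√[K, P] ≤ √[P, P]`
allows membership in the radical to be lifted to `P`.

Independence of the choice comes from a rigidity property. If `K` is central, then `K [E, E] = 0`,
and if `K` is also reduced, then `K √[E, E] = 0`. For an endomorphism `e` over `B` and `a` in `K ∧
√[E, E]`, the difference `e a - a` lies in `K` and in `√[E, E]`, so its square vanishes and `e a =
a`. Thus extensions that map to each other have isomorphic Galois groups.

Admissibility holds because commutators lift along surjections, and protoadditivity because a
section carries nilpotents to nilpotents. -/

theorem mul_ppow_comm {x y : A} (h : x * y = y * x) (n : ℕ) : x * ppow y n = ppow y n * x := by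
  induction n with
  | zero => exact h
  | succ n ih => rw [ppow, ← mul_assoc, ih, mul_assoc, h, mul_assoc]

theorem ppow_mul_of_comm {x y : A} (h : x * y = y * x) (n : ℕ) :
    ppow (x * y) n = ppow x n * ppow y n := by
  induction n with
  | zero => rfl
  | succ n ih =>
    rw [ppow, ih, ppow, ppow, mul_assoc, ← mul_assoc (ppow y n), ← mul_ppow_comm h n]
    simp only [mul_assoc]

namespace TwoSidedIdeal

theorem ppow_mem {J : TwoSidedIdeal A} {x : A} (hx : x ∈ J) (n : ℕ) : ppow x n ∈ J := by
  cases n with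
  | zero => exact hx
  | succ n => exact J.mul_mem_left _ _ hx

theorem coe_ppow {K : TwoSidedIdeal A} (k : K) (n : ℕ) : ((ppow k n : K) : A) = ppow (k : A) n :=
  map_ppow K.incl k n

/-- The image of a two-sided ideal under a surjective homomorphism. -/
def image (J : TwoSidedIdeal A) (g : A →ₙ+* B) (hg : Function.Surjective g) : TwoSidedIdeal B :=
  TwoSidedIdeal.mk' {b | ∃ a ∈ J, g a = b}
    ⟨0, J.zero_mem, map_zero g⟩
    (by
      rintro _ _ ⟨x, hx, rfl⟩ ⟨y, hy, rfl⟩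
      exact ⟨x + y, J.add_mem hx hy, map_add g x y⟩)
    (by
      rintro _ ⟨x, hx, rfl⟩
      exact ⟨-x, J.neg_mem hx, map_neg g x⟩)
    (by
      rintro z _ ⟨y, hy, rfl⟩
      obtain ⟨x, rfl⟩ := hg z
      exact ⟨x * y, J.mul_mem_left _ _ hy, map_mul g x y⟩)
    (by
      rintro _ z ⟨x, hx, rfl⟩
      obtain ⟨y, rfl⟩ := hg z
      exact ⟨x * y, J.mul_mem_right _ _ hx, map_mul g x y⟩)

theorem mem_image {J : TwoSidedIdeal A} {g : A →ₙ+* B} {hg : Function.Surjective g} {b : B} :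
    b ∈ J.image g hg ↔ ∃ a ∈ J, g a = b :=
  TwoSidedIdeal.mem_mk' _ _ _ _ _ _ _

theorem map_mem_commutatorIdeal (g : A →ₙ+* B) {a : A} (ha : a ∈ commutatorIdeal A) :
    g a ∈ commutatorIdeal B := by
  have h : commutatorIdeal A ≤ TwoSidedIdeal.comap g (commutatorIdeal B) := by
    refine TwoSidedIdeal.span_le.2 ?_
    rintro _ ⟨x, y, rfl⟩
    rw [SetLike.mem_coe, TwoSidedIdeal.mem_comap, map_sub, map_mul, map_mul]
    exact commutator_mem _ _
  exact (TwoSidedIdeal.mem_comap g).1 (h ha)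

/-- The image of an ideal under a surjection is an ideal, and the image of the commutator ideal
contains the generators. Surjectivity serves twice: for the ideal property and for lifting the
generators. -/
theorem exists_mem_commutatorIdeal {g : A →ₙ+* B} (hg : Function.Surjective g) {b : B}
    (hb : b ∈ commutatorIdeal B) : ∃ a ∈ commutatorIdeal A, g a = b := by
  have h : commutatorIdeal B ≤ (commutatorIdeal A).image g hg := by
    refine TwoSidedIdeal.span_le.2 ?_
    rintro _ ⟨x, y, rfl⟩
    obtain ⟨x, rfl⟩ := hg x
    obtain ⟨y, rfl⟩ := hg y
    exact mem_image.2 ⟨_, commutator_mem x y, by rw [map_sub, map_mul, map_mul]⟩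
  exact mem_image.1 (h hb)

theorem commutatorIdeal_eq_bot (h : ∀ x y : A, x * y = y * x) : commutatorIdeal A = ⊥ := by
  refine le_antisymm (TwoSidedIdeal.span_le.2 ?_) bot_le
  rintro _ ⟨x, y, rfl⟩
  rw [SetLike.mem_coe, TwoSidedIdeal.mem_bot, h x y, sub_self]

/-! ### The relative commutator `[K, A]` and its radical -/

variable (K : TwoSidedIdeal A)

theorem commutatorWith_le : K.commutatorWith ≤ K := by
  refine TwoSidedIdeal.span_le.2 ?_
  rintro _ ⟨k, hk, a, rfl⟩
  exact K.sub_mem (K.mul_mem_left _ _ hk) (K.mul_mem_right _ _ hk)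

theorem commutatorWith_le_commutatorIdeal : K.commutatorWith ≤ commutatorIdeal A := by
  refine TwoSidedIdeal.span_le.2 ?_
  rintro _ ⟨k, -, a, rfl⟩
  exact commutator_mem a k

theorem commutatorWith_top : (⊤ : TwoSidedIdeal A).commutatorWith = commutatorIdeal A := by
  refine le_antisymm (commutatorWith_le_commutatorIdeal _) (TwoSidedIdeal.span_le.2 ?_)
  rintro _ ⟨x, y, rfl⟩
  exact TwoSidedIdeal.subset_span ⟨y, TwoSidedIdeal.mem_top A, x, rfl⟩

variable {K}

theorem commutatorWith_mem {k : A} (hk : k ∈ K) (a : A) : a * k - k * a ∈ K.commutatorWith :=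
  TwoSidedIdeal.subset_span ⟨k, hk, a, rfl⟩

theorem commutatorWith_mem' {k : A} (hk : k ∈ K) (a : A) : k * a - a * k ∈ K.commutatorWith := by
  rw [← neg_sub]
  exact K.commutatorWith.neg_mem (commutatorWith_mem hk a)

theorem commutatorWith_eq_bot (h : ∀ k ∈ K, ∀ a, a * k = k * a) : K.commutatorWith = ⊥ := by
  refine le_antisymm (TwoSidedIdeal.span_le.2 ?_) bot_le
  rintro _ ⟨k, hk, a, rfl⟩
  rw [SetLike.mem_coe, TwoSidedIdeal.mem_bot, h k hk a, sub_self]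

/-- The elements `z` such that `K z` and `z K` lie in `[K, A]`. -/
def commutatorAnnihilator (K : TwoSidedIdeal A) : TwoSidedIdeal A :=
  TwoSidedIdeal.mk' {z | ∀ k ∈ K, k * z ∈ K.commutatorWith ∧ z * k ∈ K.commutatorWith}
    (fun k _ => by simp)
    (fun {x y} hx hy k hk => by
      rw [mul_add, add_mul]
      exact ⟨AddMemClass.add_mem (hx k hk).1 (hy k hk).1,
        AddMemClass.add_mem (hx k hk).2 (hy k hk).2⟩)
    (fun {x} hx k hk => by
      rw [mul_neg, neg_mul]
      exact ⟨NegMemClass.neg_mem (hx k hk).1, NegMemClass.neg_mem (hx k hk).2⟩)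
    (fun {x y} hy k hk => by
      rw [← mul_assoc, mul_assoc x]
      exact ⟨(hy _ (K.mul_mem_right _ _ hk)).1, TwoSidedIdeal.mul_mem_left _ _ _ (hy k hk).2⟩)
    (fun {x y} hx k hk => by
      rw [← mul_assoc, mul_assoc x]
      exact ⟨TwoSidedIdeal.mul_mem_right _ _ _ (hx k hk).1, (hx _ (K.mul_mem_left _ _ hk)).2⟩)

theorem mem_commutatorAnnihilator {z : A} : z ∈ K.commutatorAnnihilator ↔
    ∀ k ∈ K, k * z ∈ K.commutatorWith ∧ z * k ∈ K.commutatorWith :=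
  TwoSidedIdeal.mem_mk' _ _ _ _ _ _ _

/-- Writing `[x, y] = x y - y x`, one has `k [a, b] = [k a, b] + [b, k] a`, where `k a` is again in
`K`; the other side is symmetric. When `K` is central this says that `K` annihilates all
commutators. -/
theorem commutatorIdeal_le_annihilator : commutatorIdeal A ≤ K.commutatorAnnihilator := by
  refine TwoSidedIdeal.span_le.2 ?_
  rintro _ ⟨a, b, rfl⟩
  refine mem_commutatorAnnihilator.2 fun k hk => ⟨?_, ?_⟩
  · have : k * (a * b - b * a) = ((k * a) * b - b * (k * a)) + (b * k - k * b) * a := by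
      noncomm_ring
    rw [this]
    exact AddMemClass.add_mem (commutatorWith_mem' (K.mul_mem_right _ _ hk) b)
      (TwoSidedIdeal.mul_mem_right _ _ _ (commutatorWith_mem hk b))
  · have : (a * b - b * a) * k = a * (b * k - k * b) + ((a * k) * b - b * (a * k)) := by
      noncomm_ring
    rw [this]
    exact AddMemClass.add_mem (TwoSidedIdeal.mul_mem_left _ _ _ (commutatorWith_mem hk b))
      (commutatorWith_mem' (K.mul_mem_left _ _ hk) b)

/-- The elements with the desired property need not form an ideal: expanding `π₂ (x y) - π₁ (x y)`
produces a term `(π₂ x - π₁ x) π₁ y`. The induction is therefore strengthened by requiring that `π₁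
r` annihilate `K` modulo `[K, A]`, which commutators satisfy by the preceding lemma. -/
theorem mem_commutatorWith_of_kernelPair {R : Type u₂} [NonUnitalRing R] {π₁ π₂ : R →ₙ+* A}
    (hw : ∀ r, π₂ r - π₁ r ∈ K) {r : R} (hr : r ∈ commutatorIdeal R) :
    π₂ r - π₁ r ∈ K.commutatorWith := by
  let T : TwoSidedIdeal R := TwoSidedIdeal.mk'
    {r | π₂ r - π₁ r ∈ K.commutatorWith ∧ π₁ r ∈ K.commutatorAnnihilator}
    (by simp)
    (fun {x y} hx hy => by
      refine ⟨?_, by rw [map_add]; exact AddMemClass.add_mem hx.2 hy.2⟩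
      rw [map_add, map_add, add_sub_add_comm]
      exact AddMemClass.add_mem hx.1 hy.1)
    (fun {x} hx => by
      refine ⟨?_, by rw [map_neg]; exact NegMemClass.neg_mem hx.2⟩
      rw [map_neg, map_neg, neg_sub_neg, ← neg_sub]
      exact NegMemClass.neg_mem hx.1)
    (fun {x y} hy => by
      refine ⟨?_, by rw [map_mul]; exact TwoSidedIdeal.mul_mem_left _ _ _ hy.2⟩
      have : π₂ (x * y) - π₁ (x * y) =
          π₂ x * (π₂ y - π₁ y) + (π₂ x - π₁ x) * π₁ y := by
        rw [map_mul, map_mul]; noncomm_ring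
      rw [this]
      exact AddMemClass.add_mem (TwoSidedIdeal.mul_mem_left _ _ _ hy.1)
        (mem_commutatorAnnihilator.1 hy.2 _ (hw x)).1)
    (fun {x y} hx => by
      refine ⟨?_, by rw [map_mul]; exact TwoSidedIdeal.mul_mem_right _ _ _ hx.2⟩
      have : π₂ (x * y) - π₁ (x * y) =
          (π₂ x - π₁ x) * π₂ y + π₁ x * (π₂ y - π₁ y) := by
        rw [map_mul, map_mul]; noncomm_ring
      rw [this]
      exact AddMemClass.add_mem (TwoSidedIdeal.mul_mem_right _ _ _ hx.1)
        (mem_commutatorAnnihilator.1 hx.2 _ (hw y)).2)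
  have h : commutatorIdeal R ≤ T := by
    refine TwoSidedIdeal.span_le.2 ?_
    rintro _ ⟨x, y, rfl⟩
    refine (TwoSidedIdeal.mem_mk' _ _ _ _ _ _ _).2 ⟨?_, ?_⟩
    · have : π₂ (x * y - y * x) - π₁ (x * y - y * x) =
          (π₂ x * (π₂ y - π₁ y) - (π₂ y - π₁ y) * π₂ x) +
          ((π₂ x - π₁ x) * π₁ y - π₁ y * (π₂ x - π₁ x)) := by
        simp only [map_sub, map_mul]; noncomm_ring
      rw [this]
      exact AddMemClass.add_mem (commutatorWith_mem (hw y) _) (commutatorWith_mem' (hw x) _)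
    · rw [map_sub, map_mul, map_mul]
      exact commutatorIdeal_le_annihilator (commutator_mem _ _)
  exact ((TwoSidedIdeal.mem_mk' _ _ _ _ _ _ _).1 (h hr)).1

/-- Two descriptions of the relative commutator `[K, A]`, in terms of the kernel pair of a
homomorphism with kernel `K` and in terms of generators. -/
theorem exists_kernelPair_iff {R : Type u₂} [NonUnitalRing R] {π₁ π₂ : R →ₙ+* A}
    (hw : ∀ r, π₂ r - π₁ r ∈ K)
    (hex : ∀ x y, y - x ∈ K → ∃ r, π₁ r = x ∧ π₂ r = y) (a : A) :
    (∃ r ∈ commutatorIdeal R, π₁ r = 0 ∧ π₂ r = a) ↔ a ∈ K.commutatorWith := by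
  constructor
  · rintro ⟨r, hr, h₁, rfl⟩
    simpa [h₁] using mem_commutatorWith_of_kernelPair hw hr
  · have hs : Function.Surjective π₂ := fun x => by
      obtain ⟨r, -, hr⟩ := hex x x (by rw [sub_self]; exact K.zero_mem)
      exact ⟨r, hr⟩
    have h : K.commutatorWith ≤ (commutatorIdeal R ⊓ TwoSidedIdeal.ker π₁).image π₂ hs := by
      refine TwoSidedIdeal.span_le.2 ?_
      rintro _ ⟨k, hk, a, rfl⟩
      obtain ⟨r, hr₁, hr₂⟩ := hex a a (by rw [sub_self]; exact K.zero_mem)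
      -- With `r = (a, a)` and `s = (0, k)` in the kernel pair, the commutator of `r` and `s` is
      -- `(0, a k - k a)`.
      obtain ⟨s, hs₁, hs₂⟩ := hex 0 k (by rwa [sub_zero])
      refine mem_image.2 ⟨r * s - s * r, (TwoSidedIdeal.mem_inf R).2 ⟨commutator_mem r s, ?_⟩, ?_⟩
      · rw [TwoSidedIdeal.mem_ker, map_sub, map_mul, map_mul, hs₁, mul_zero, zero_mul, sub_self]
      · rw [map_sub, map_mul, map_mul, hr₂, hs₂]
    intro ha
    obtain ⟨r, hr, rfl⟩ := mem_image.1 (h ha)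
    exact ⟨r, ((TwoSidedIdeal.mem_inf R).1 hr).1,
      (TwoSidedIdeal.mem_ker (f := π₁)).1 ((TwoSidedIdeal.mem_inf R).1 hr).2, rfl⟩

/-- The radical `√[K, A]` in `K`, which is an ideal of `A`. -/
def radicalWith (K : TwoSidedIdeal A) : TwoSidedIdeal A :=
  TwoSidedIdeal.mk' {a | a ∈ K ∧ ∃ n, ppow a n ∈ K.commutatorWith}
    ⟨K.zero_mem, 0, K.commutatorWith.zero_mem⟩
    (fun {x y} hx hy => by
      -- Sums are formed in the ring `K`, where `commutatorIn` contains all commutators, so the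
      -- commutative argument behind `radical` applies there.
      have key : ∀ z : K, z ∈ K.commutatorIn.radical K.commutatorIn_mem ↔
          ∃ n, ppow (z : A) n ∈ K.commutatorWith := fun z => by
        rw [mem_radical]
        refine exists_congr fun n => ?_
        rw [← coe_ppow]
        exact TwoSidedIdeal.mem_comap K.incl
      exact ⟨AddMemClass.add_mem hx.1 hy.1, (key (⟨x, hx.1⟩ + ⟨y, hy.1⟩)).1
        (AddMemClass.add_mem ((key ⟨x, hx.1⟩).2 hx.2) ((key ⟨y, hy.1⟩).2 hy.2))⟩)
    (fun {x} hx => by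
      obtain ⟨hK, n, hn⟩ := hx
      refine ⟨NegMemClass.neg_mem hK, n, ?_⟩
      have h : ppow (-x) n = ppow x n ∨ ppow (-x) n = -ppow x n := by
        clear hn
        induction n with
        | zero => exact Or.inr rfl
        | succ n ih => rcases ih with ih | ih <;> simp [ppow, ih]
      rcases h with h | h <;> rw [h]
      · exact hn
      · exact NegMemClass.neg_mem hn)
    (fun {a k} hk => by
      obtain ⟨hK, n, hn⟩ := hk
      refine ⟨K.mul_mem_left _ _ hK, n, ?_⟩
      rw [← quotMk_eq_zero] at hn ⊢
      -- Modulo `[K, A]` the elements `a` and `k` commute, so the powers of `a k` split as products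
      -- of powers.
      have h : K.commutatorWith.quotMk a * K.commutatorWith.quotMk k =
          K.commutatorWith.quotMk k * K.commutatorWith.quotMk a := by
        rw [← sub_eq_zero, ← map_mul, ← map_mul, ← map_sub, quotMk_eq_zero]
        exact commutatorWith_mem hK a
      rw [map_ppow] at hn
      rw [map_ppow, map_mul, ppow_mul_of_comm h, hn, mul_zero])
    (fun {k a} hk => by
      obtain ⟨hK, n, hn⟩ := hk
      refine ⟨K.mul_mem_right _ _ hK, n, ?_⟩
      rw [← quotMk_eq_zero] at hn ⊢
      have h : K.commutatorWith.quotMk k * K.commutatorWith.quotMk a =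
          K.commutatorWith.quotMk a * K.commutatorWith.quotMk k := by
        rw [← sub_eq_zero, ← map_mul, ← map_mul, ← map_sub, quotMk_eq_zero]
        exact commutatorWith_mem' hK a
      rw [map_ppow] at hn
      rw [map_ppow, map_mul, ppow_mul_of_comm h, hn, zero_mul])

theorem mem_radicalWith {a : A} :
    a ∈ K.radicalWith ↔ a ∈ K ∧ ∃ n, ppow a n ∈ K.commutatorWith :=
  TwoSidedIdeal.mem_mk' _ _ _ _ _ _ _

theorem radicalWith_le : K.radicalWith ≤ K := fun _ h => (mem_radicalWith.1 h).1

theorem mem_radical_commutatorIn {k : K} :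
    k ∈ K.commutatorIn.radical K.commutatorIn_mem ↔ (k : A) ∈ K.radicalWith := by
  rw [mem_radical, mem_radicalWith]
  refine (exists_congr fun n => ?_).trans (and_iff_right k.2).symm
  rw [← coe_ppow]
  exact TwoSidedIdeal.mem_comap K.incl

end TwoSidedIdeal

end NonUnital

namespace Rng

theorem mem_radicalCommutator {A : Rng.{u}} {a : A} :
    a ∈ A.radicalCommutator ↔ ∃ n, ppow a n ∈ TwoSidedIdeal.commutatorIdeal A :=
  TwoSidedIdeal.mem_radical _ _ _

theorem radicalWith_le_radicalCommutator {A : Rng.{u}} (K : TwoSidedIdeal A) :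
    K.radicalWith ≤ A.radicalCommutator := fun _ h => by
  obtain ⟨n, hn⟩ := (TwoSidedIdeal.mem_radicalWith.1 h).2
  exact mem_radicalCommutator.2 ⟨n, K.commutatorWith_le_commutatorIdeal hn⟩

theorem mem_radicalCommutator_of_ppow {A : Rng.{u}} {a : A} {n : ℕ}
    (h : ppow a n ∈ A.radicalCommutator) : a ∈ A.radicalCommutator := by
  obtain ⟨m, hm⟩ := mem_radicalCommutator.1 h
  rw [RedCRng.ppow_ppow] at hm
  exact mem_radicalCommutator.2 ⟨_, hm⟩

theorem map_mem_radicalCommutator {A B : Rng.{u}} (g : A ⟶ B) {a : A}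
    (ha : a ∈ A.radicalCommutator) : g.hom a ∈ B.radicalCommutator := by
  obtain ⟨n, hn⟩ := mem_radicalCommutator.1 ha
  exact mem_radicalCommutator.2 ⟨n, by
    rw [← map_ppow]; exact TwoSidedIdeal.map_mem_commutatorIdeal _ hn⟩

end Rng

/-! ### Pullbacks and isomorphisms of rings, elementwise -/

namespace Rng

theorem isIso_of_bijective {A B : Rng.{u}} (f : A ⟶ B) (hf : Function.Bijective f.hom) :
    IsIso f := by
  let e : A ≃+* B := RingEquiv.ofBijective f.hom hf
  exact ⟨⟨⟨(e.symm : B →ₙ+* A)⟩, elem_ext fun a => e.symm_apply_apply a,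
    elem_ext fun b => e.apply_symm_apply b⟩⟩

theorem bijective_of_isIso {A B : Rng.{u}} (f : A ⟶ B) [IsIso f] : Function.Bijective f.hom :=
  Function.bijective_iff_has_inverse.2
    ⟨(inv f).hom, congr_elem (IsIso.hom_inv_id f), congr_elem (IsIso.inv_hom_id f)⟩

/-- A bijective homomorphism as an isomorphism of `Rng`. -/
noncomputable def isoOfBijective {A B : Type u} [NonUnitalRing A] [NonUnitalRing B] (f : A →ₙ+* B)
    (hf : Function.Bijective f) : of A ≅ of B :=
  haveI := isIso_of_bijective (ofHom f) hf
  asIso (ofHom f)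

/-- Two rings that embed in a third one with the same image are isomorphic. -/
theorem nonempty_iso_of_range_eq {A B C : Type u} [NonUnitalRing A] [NonUnitalRing B]
    [NonUnitalRing C] {f : A →ₙ+* C} {g : B →ₙ+* C} (hf : Function.Injective f)
    (hg : Function.Injective g) (h : Set.range f = Set.range g) : Nonempty (of A ≅ of B) := by
  have hfg : ∀ a, ∃ b, g b = f a := fun a => h.subset ⟨a, rfl⟩
  choose φ hφ using hfg
  refine ⟨isoOfBijective
    { toFun := φ
      map_zero' := hg (by rw [hφ, map_zero, map_zero])
      map_add' := fun x y => hg (by rw [hφ, map_add, map_add, hφ, hφ])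
      map_mul' := fun x y => hg (by rw [hφ, map_mul, map_mul, hφ, hφ]) } ⟨?_, ?_⟩⟩
  · intro x y hxy
    exact hf (by rw [← hφ, ← hφ]; exact congrArg g hxy)
  · intro b
    obtain ⟨a, ha⟩ := h.superset ⟨b, rfl⟩
    exact ⟨a, hg ((hφ a).trans ha)⟩

section IsPullback

variable {P A B C : Rng.{u}} {p : P ⟶ A} {q : P ⟶ B} {f : A ⟶ C} {g : B ⟶ C}

theorem exists_of_isPullback (h : IsPullback p q f g) {x : A} {y : B} (hxy : f.hom x = g.hom y) :
    ∃ z, p.hom z = x ∧ q.hom z = y := by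
  have hw := (isPullback_fibreProduct f g).w
  let z : fibreProduct f g := ⟨(x, y), hxy⟩
  exact ⟨(h.lift _ _ hw).hom z, congr_elem (h.lift_fst _ _ hw) z, congr_elem (h.lift_snd _ _ hw) z⟩

theorem ext_of_isPullback (h : IsPullback p q f g) {z z' : P} (h₁ : p.hom z = p.hom z')
    (h₂ : q.hom z = q.hom z') : z = z' := by
  let e := h.isoIsPullback _ _ (isPullback_fibreProduct f g)
  have hfst := h.isoIsPullback_hom_fst _ _ (isPullback_fibreProduct f g)
  have hsnd := h.isoIsPullback_hom_snd _ _ (isPullback_fibreProduct f g)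
  refine (bijective_of_isIso e.hom).1 (Subtype.ext (Prod.ext ?_ ?_))
  · exact (congr_elem hfst z).trans (h₁.trans (congr_elem hfst z').symm)
  · exact (congr_elem hsnd z).trans (h₂.trans (congr_elem hsnd z').symm)

/-- The comparison map to the concrete fibre product is bijective; by additivity, injectivity need
only be tested at zero. -/
theorem isPullback_of_forall (w : p ≫ f = q ≫ g)
    (hinj : ∀ z : P, p.hom z = 0 → q.hom z = 0 → z = 0)
    (hex : ∀ x y, f.hom x = g.hom y → ∃ z, p.hom z = x ∧ q.hom z = y) : IsPullback p q f g := by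
  have hF := isPullback_fibreProduct f g
  let i : P ⟶ of (fibreProduct f g) := hF.lift p q w
  have hfst : i ≫ fibreFst f g = p := hF.lift_fst p q w
  have hsnd : i ≫ fibreSnd f g = q := hF.lift_snd p q w
  have : IsIso i := by
    refine isIso_of_bijective i ⟨(injective_iff_map_eq_zero i.hom).2 fun z hz => ?_, fun z => ?_⟩
    · refine hinj z ?_ ?_
      · rw [← hfst]
        exact (congrArg (fibreFst f g).hom hz).trans (map_zero _)
      · rw [← hsnd]
        exact (congrArg (fibreSnd f g).hom hz).trans (map_zero _)
    · obtain ⟨y, h₁, h₂⟩ := hex _ _ z.2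
      exact ⟨y, Subtype.ext (Prod.ext ((congr_elem hfst y).trans h₁)
        ((congr_elem hsnd y).trans h₂))⟩
  exact IsPullback.of_iso hF (asIso i).symm (Iso.refl _) (Iso.refl _) (Iso.refl _)
    (by simp [← hfst]) (by simp [← hsnd]) (by simp) (by simp)

end IsPullback

theorem mem_kernelIdeal {A B : Rng.{u}} {f : A ⟶ B} {a : A} :
    a ∈ kernelIdeal f ↔ f.hom a = 0 :=
  TwoSidedIdeal.mem_ker (f := f.hom)

/-! ### The units of the reflections, closures and relative commutators -/

theorem exists_mem_commutatorIdeal_iff {R A B : Rng.{u}} {f : A ⟶ B} {π₁ π₂ : R ⟶ A}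
    (h : IsPullback π₁ π₂ f f) (a : A) :
    (∃ r ∈ TwoSidedIdeal.commutatorIdeal R, π₁.hom r = 0 ∧ π₂.hom r = a) ↔
      a ∈ (kernelIdeal f).commutatorWith := by
  refine TwoSidedIdeal.exists_kernelPair_iff (fun r => ?_) (fun x y hxy => ?_) a
  · rw [mem_kernelIdeal, map_sub, sub_eq_zero]
    exact (congr_elem h.w r).symm
  · rw [mem_kernelIdeal, map_sub, sub_eq_zero] at hxy
    exact exists_of_isPullback h hxy.symm

theorem relativeCommutator_eq {A B : Rng.{u}} (f : A ⟶ B) :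
    relativeCommutator CRng.inclusion.{u} f = ((kernelIdeal f).commutatorWith : Set A) := by
  ext a
  rw [SetLike.mem_coe, ← exists_mem_commutatorIdeal_iff (IsPullback.of_hasPullback f f)]
  exact exists_congr fun r => and_congr_left fun _ => TwoSidedIdeal.quotMk_eq_zero _ r

theorem relativeCommutator_from_zero (P : Rng.{u}) :
    relativeCommutator CRng.inclusion.{u} ((isZero_zero Rng.{u}).from_ P) =
      (TwoSidedIdeal.commutatorIdeal P : Set P) := by
  rw [relativeCommutator_eq, ← TwoSidedIdeal.commutatorWith_top]
  congr 2
  refine top_unique fun a _ => mem_kernelIdeal.2 ?_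
  have h : (isZero_zero Rng.{u}).from_ P = ⟨0⟩ := (isZero_zero Rng.{u}).eq_of_tgt _ _
  exact congr_elem h a

end Rng

namespace RedCRng

/-- The unit of the composite reflection. -/
abbrev unit (A : Rng.{u}) : A ⟶ toRng.obj ((reflector toRng.{u}).obj A) :=
  (reflectorAdjunction toRng.{u}).unit.app A

theorem unit_eq_zero_iff {A : Rng.{u}} {a : A} :
    (unit A).hom a = 0 ↔ a ∈ A.radicalCommutator := by
  refine (TwoSidedIdeal.quotMk_eq_zero _ (TwoSidedIdeal.quotMk _ a)).trans ?_
  refine (mem_nilradical _ _).trans ?_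
  rw [Rng.mem_radicalCommutator]
  refine exists_congr fun n => ?_
  rw [← TwoSidedIdeal.quotMk_eq_zero, map_ppow]
  rfl

theorem map_unit {A B : Rng.{u}} (f : A ⟶ B) (a : A) :
    (toRng.map ((reflector toRng).map f)).hom ((unit A).hom a) = (unit B).hom (f.hom a) :=
  (Rng.congr_elem ((reflectorAdjunction toRng.{u}).unit.naturality f) a).symm

theorem unit_inclusion_eq_zero_iff {A : CRng.{u}} {a : A.obj} :
    ((reflectorAdjunction inclusion.{u}).unit.app A).hom.hom a = 0 ↔ a ∈ nilradical A :=
  TwoSidedIdeal.quotMk_eq_zero _ a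

theorem unit_inclusion_surjective (A : CRng.{u}) :
    Function.Surjective ((reflectorAdjunction inclusion.{u}).unit.app A).hom.hom :=
  TwoSidedIdeal.quotMk_surjective _

theorem map_unit_inclusion {A B : CRng.{u}} (f : A ⟶ B) (a : A.obj) :
    (toRng.map ((reflector inclusion).map f)).hom
      (((reflectorAdjunction inclusion.{u}).unit.app A).hom.hom a) =
      ((reflectorAdjunction inclusion.{u}).unit.app B).hom.hom (f.hom.hom a) :=
  (Rng.congr_elem (congrArg (fun g => g.hom)
    ((reflectorAdjunction inclusion.{u}).unit.naturality f)) a).symm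

theorem closure_inclusion (A : CRng.{u}) (J : TwoSidedIdeal A.obj) :
    CRng.closure inclusion.{u} A J = J.radical (A.commutator_mem J) := by
  refine TwoSidedIdeal.ext fun a => ?_
  refine (unit_inclusion_eq_zero_iff (A := A.quotient J)).trans ?_
  rw [TwoSidedIdeal.mem_radical]
  refine (mem_nilradical _ _).trans (exists_congr fun n => ?_)
  rw [← TwoSidedIdeal.quotMk_eq_zero, map_ppow]
  rfl

/-- Since `A / J` is already commutative, its commutator ideal vanishes and only nilpotents are
killed by the unit. -/
theorem closure_toRng {A : Type u} [NonUnitalRing A] (J : TwoSidedIdeal A)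
    (hJ : ∀ x y : A, x * y - y * x ∈ J) : Rng.closure toRng.{u} J = J.radical hJ := by
  refine TwoSidedIdeal.ext fun a => ?_
  refine (unit_eq_zero_iff (A := Rng.of J.Quo)).trans ?_
  rw [TwoSidedIdeal.mem_radical, Rng.mem_radicalCommutator]
  refine exists_congr fun n => ?_
  have h : TwoSidedIdeal.commutatorIdeal (Rng.of J.Quo) = ⊥ :=
    TwoSidedIdeal.commutatorIdeal_eq_bot (J.quot_comm hJ)
  rw [h, TwoSidedIdeal.mem_bot, ← TwoSidedIdeal.quotMk_eq_zero, map_ppow]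

theorem isIso_of_bijective {X Y : RedCRng.{u}} (f : X ⟶ Y)
    (hf : Function.Bijective (toRng.map f).hom) : IsIso f :=
  haveI := Rng.isIso_of_bijective _ hf
  isIso_of_reflects_iso f toRng

/-! ### Admissibility and protoadditivity -/

/-- This is the adjunction bijection written out. It lets the comparison map be computed on elements
of `Q`, because the unit is surjective. -/
theorem unit_map_counit {Q : Rng.{u}} {X : RedCRng.{u}} (g : Q ⟶ toRng.obj X) :
    unit Q ≫ toRng.map ((reflector toRng).map g ≫ (reflectorAdjunction toRng).counit.app X) = g :=
  ((reflectorAdjunction toRng.{u}).homEquiv_unit _ _ _).symm.trans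
    (((reflectorAdjunction toRng.{u}).homEquiv Q X).symm_apply_eq.1
      ((reflectorAdjunction toRng.{u}).homEquiv_counit _ _ _)).symm

theorem isIso_map_counit {B Q : Rng.{u}} {X : RedCRng.{u}}
    {φ : X ⟶ (reflector toRng.{u}).obj B} (hφ : Function.Surjective (toRng.map φ).hom)
    {π₁ : Q ⟶ B} {π₂ : Q ⟶ toRng.obj X} (h : IsPullback π₁ π₂ (unit B) (toRng.map φ)) :
    IsIso ((reflector toRng).map π₂ ≫ (reflectorAdjunction toRng).counit.app X) := by
  have hη := unit_map_counit π₂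
  apply isIso_of_bijective
  constructor
  · refine (injective_iff_map_eq_zero _).2 fun x hx => ?_
    obtain ⟨q, rfl⟩ := unit_surjective Q x
    have hq : π₂.hom q = 0 := (Rng.congr_elem hη q).symm.trans hx
    refine unit_eq_zero_iff.2 ?_
    have hb : π₁.hom q ∈ B.radicalCommutator := by
      refine unit_eq_zero_iff.1 ((Rng.congr_elem h.w q).trans ?_)
      exact (congrArg (toRng.map φ).hom hq).trans (map_zero _)
    obtain ⟨n, hn⟩ := Rng.mem_radicalCommutator.1 hb
    have hs : Function.Surjective π₁.hom := fun b => by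
      obtain ⟨x, hx⟩ := hφ ((unit B).hom b)
      obtain ⟨z, hz, -⟩ := Rng.exists_of_isPullback h hx.symm
      exact ⟨z, hz⟩
    -- A power of `π₁ q` lies in the commutator ideal of `B`; lift it to `z` in that of `Q`. As `X`
    -- is commutative, `π₂ z = 0`, so `z` has the same two projections as that power of `q` and
    -- equals it.
    obtain ⟨z, hz, hzn⟩ := TwoSidedIdeal.exists_mem_commutatorIdeal hs hn
    refine Rng.mem_radicalCommutator.2 ⟨n, ?_⟩
    have hzq : z = ppow q n := by
      refine Rng.ext_of_isPullback h (hzn.trans (map_ppow _ q n).symm) ?_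
      have h₀ := TwoSidedIdeal.map_mem_commutatorIdeal π₂.hom hz
      rw [TwoSidedIdeal.commutatorIdeal_eq_bot (A := toRng.obj X) X.obj.property,
        TwoSidedIdeal.mem_bot] at h₀
      rw [h₀, map_ppow, hq]
      exact ((TwoSidedIdeal.mem_bot _).1 (TwoSidedIdeal.ppow_mem (TwoSidedIdeal.zero_mem ⊥) n)).symm
    rwa [← hzq]
  · intro x
    obtain ⟨b, hb⟩ := unit_surjective B ((toRng.map φ).hom x)
    obtain ⟨z, -, hz⟩ := Rng.exists_of_isPullback h hb
    exact ⟨(unit Q).hom z, (Rng.congr_elem hη z).trans hz⟩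

theorem admissible : galoisStructure.{u}.Admissible := fun _ _ _ hφ _ _ _ h =>
  isIso_map_counit ((Rng.isRegularEpi_iff_surjective _).1 hφ) h

open ZeroObject

theorem subsingleton_of_isZero {A : CRng.{u}} (h : IsZero A) : Subsingleton A.obj :=
  ⟨fun x y => by
    have h₀ : 𝟙 A = ObjectProperty.homMk (⟨0⟩ : A.obj ⟶ A.obj) := h.eq_of_src _ _
    have key : ∀ x : A.obj, x = 0 := Rng.congr_elem (congrArg (fun g => g.hom) h₀)
    rw [key x, key y]⟩

instance : Subsingleton (0 : CRng.{u}).obj := subsingleton_of_isZero (isZero_zero _)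

instance : Subsingleton (toRng.obj (0 : RedCRng.{u})) :=
  ⟨fun x y => by
    have h₀ : 𝟙 (0 : RedCRng.{u}) =
        ObjectProperty.homMk (ObjectProperty.homMk (Rng.Hom.mk 0)) := (isZero_zero _).eq_of_src _ _
    have key : ∀ x : toRng.obj (0 : RedCRng.{u}), x = 0 :=
      Rng.congr_elem (congrArg (fun g => g.hom.hom) h₀)
    rw [key x, key y]⟩

instance (A : CRng.{u}) [Subsingleton A.obj] :
    Subsingleton (toRng.obj ((reflector inclusion.{u}).obj A)) :=
  @Function.Surjective.subsingleton A.obj _ _ _ (unit_inclusion_surjective A)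

/-- The kernel maps injectively because nilpotency of an element of `K` can be tested in `A`. The
splitting is needed for exactness in the middle: if `f a` is nilpotent then so is `s (f a)`, and `a`
may be replaced by `a - s (f a)`, which comes from `K`. -/
theorem isPullback_map_reflector {K A B : CRng.{u}} {k : K ⟶ A} {f : A ⟶ B} {s : B ⟶ A}
    (h : IsSplitShortExact k f s) :
    IsPullback ((reflector inclusion).map k) ((isZero_zero RedCRng.{u}).from_ _)
      ((reflector inclusion).map f) ((isZero_zero RedCRng.{u}).to_ _) := by
  have hK := h.isKernel.map CRng.inclusion
  have hs : ∀ b, f.hom.hom (s.hom.hom b) = b :=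
    Rng.congr_elem (congrArg (fun g => g.hom) h.section_comp)
  have w : (reflector inclusion).map k ≫ (reflector inclusion).map f =
      (isZero_zero RedCRng.{u}).from_ _ ≫ (isZero_zero RedCRng.{u}).to_ _ := by
    rw [← Functor.map_comp, h.isKernel.w, Functor.map_comp]
    apply ObjectProperty.hom_ext
    apply ObjectProperty.hom_ext
    refine Rng.elem_ext fun x => ?_
    have e₁ : (toRng.map ((reflector inclusion).map ((isZero_zero CRng.{u}).from_ K))).hom x = 0 :=
      Subsingleton.elim _ _
    have e₂ : (toRng.map ((isZero_zero RedCRng.{u}).from_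
        ((reflector inclusion).obj K))).hom x = 0 := Subsingleton.elim _ _
    exact ((congrArg (toRng.map ((reflector inclusion).map
      ((isZero_zero CRng.{u}).to_ B))).hom e₁).trans (map_zero _)).trans
      ((congrArg (toRng.map ((isZero_zero RedCRng.{u}).to_
        ((reflector inclusion).obj B))).hom e₂).trans (map_zero _)).symm
  refine IsPullback.of_map toRng w (Rng.isPullback_of_forall ?_ ?_ ?_)
  · rw [← Functor.map_comp, w, Functor.map_comp]
  · intro z hz _
    obtain ⟨z, rfl⟩ := unit_inclusion_surjective K z
    rw [map_unit_inclusion] at hz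
    obtain ⟨n, hn⟩ := (mem_nilradical _ _).1 (unit_inclusion_eq_zero_iff.1 hz)
    refine unit_inclusion_eq_zero_iff.2 ((mem_nilradical _ _).2 ⟨n, ?_⟩)
    rw [← map_ppow] at hn
    exact Rng.ext_of_isPullback hK (hn.trans (map_zero _).symm)
      (Subsingleton.elim (α := (0 : CRng.{u}).obj) _ _)
  · intro x y hxy
    obtain ⟨a, rfl⟩ : ∃ a : A.obj, _ = x := unit_inclusion_surjective A x
    have hy : y = 0 := Subsingleton.elim (α := toRng.obj (0 : RedCRng.{u})) _ _
    rw [hy, map_zero, map_unit_inclusion] at hxy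
    obtain ⟨n, hn⟩ := (mem_nilradical _ _).1 (unit_inclusion_eq_zero_iff.1 hxy)
    have hfa : f.hom.hom (a - s.hom.hom (f.hom.hom a)) = 0 := by
      rw [map_sub, hs, sub_self]
    obtain ⟨z, hz, -⟩ := Rng.exists_of_isPullback hK (y := 0)
      (hfa.trans (map_zero _).symm)
    refine ⟨((reflectorAdjunction inclusion.{u}).unit.app K).hom.hom z, ?_,
      Subsingleton.elim (α := toRng.obj (0 : RedCRng.{u})) _ _⟩
    rw [map_unit_inclusion]
    have hsa : ((reflectorAdjunction inclusion.{u}).unit.app A).hom.hom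
        (s.hom.hom (f.hom.hom a)) = 0 := by
      refine unit_inclusion_eq_zero_iff.2 ((mem_nilradical _ _).2 ⟨n, ?_⟩)
      rw [← map_ppow, hn, map_zero]
    refine (congrArg ((reflectorAdjunction inclusion.{u}).unit.app A).hom.hom hz).trans ?_
    rw [map_sub, hsa, sub_zero]

theorem protoadditive : Protoadditive (reflector inclusion.{u}) := by
  intro K A B k f s h
  refine ⟨by rw [← Functor.map_comp, h.section_comp, CategoryTheory.Functor.map_id],
    isPullback_map_reflector h, ?_⟩
  -- The reflector is a left adjoint and preserves the pushout; it remains to replace the image of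
  -- the zero object by the chosen zero object.
  have : IsIso ((isZero_zero RedCRng.{u}).from_ ((reflector inclusion.{u}).obj 0)) :=
    isIso_of_bijective _ ⟨fun _ _ _ => Subsingleton.elim _ _, fun y =>
      ⟨0, Subsingleton.elim (α := toRng.obj (0 : RedCRng.{u})) _ _⟩⟩
  have hz : IsZero ((reflector inclusion.{u}).obj 0) :=
    (isZero_zero _).of_iso (asIso ((isZero_zero RedCRng.{u}).from_ _))
  exact IsPushout.of_iso (h.isCokernel.map (reflector inclusion)) (Iso.refl _) (Iso.refl _)
    (asIso ((isZero_zero RedCRng.{u}).from_ _)) (Iso.refl _) (by simp)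
    ((isZero_zero _).eq_of_tgt _ _) (by simp) (hz.eq_of_src _ _)

end RedCRng

/-! ### Monadicity of pulling back extensions -/

namespace Rng

theorem exists_desc {A B C : Rng.{u}} {c : A ⟶ B} (hc : Function.Surjective c.hom) (h : A ⟶ C)
    (hker : ∀ a, c.hom a = 0 → h.hom a = 0) : ∃ d : B ⟶ C, c ≫ d = h := by
  have key : ∀ a a', c.hom a = c.hom a' → h.hom a = h.hom a' := fun a a' haa' => by
    rw [← sub_eq_zero, ← map_sub] at haa' ⊢
    exact hker _ haa'
  have hinv := Function.surjInv_eq hc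
  refine ⟨⟨{ toFun := fun b => h.hom (Function.surjInv hc b)
             map_zero' := (key _ _ (by rw [hinv, map_zero])).trans (map_zero h.hom)
             map_add' := fun x y =>
               (key _ _ (by simp only [map_add, hinv])).trans (map_add h.hom _ _)
             map_mul' := fun x y =>
               (key _ _ (by simp only [map_mul, hinv])).trans (map_mul h.hom _ _) }⟩, ?_⟩
  exact elem_ext fun a => key _ _ (hinv _)

end Rng

namespace RedCRng

/-- The category of extensions (regular epimorphisms) over a ring. -/
abbrev Ext (B : Rng.{u}) := galoisStructure.{u}.ℰ.Over ⊤ B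

/-- Pulling back extensions along `p`. -/
noncomputable abbrev extPullback {E B : Rng.{u}} (p : E ⟶ B) : Ext B ⥤ Ext E :=
  MorphismProperty.Over.pullback galoisStructure.{u}.ℰ ⊤ p

theorem Ext.hom_surjective {B : Rng.{u}} (X : Ext B) : Function.Surjective X.hom.hom :=
  (Rng.isRegularEpi_iff_surjective _).1 X.prop

/-- The ideal generated by the differences of the values of two homomorphisms. -/
def differenceIdeal {X Y : Rng.{u}} (f g : X ⟶ Y) : TwoSidedIdeal Y :=
  TwoSidedIdeal.span {z | ∃ x, z = f.hom x - g.hom x}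

theorem differenceIdeal_le_ker {X Y Z : Rng.{u}} {f g : X ⟶ Y} {h : Y ⟶ Z} (w : f ≫ h = g ≫ h)
    {y : Y} (hy : y ∈ differenceIdeal f g) : h.hom y = 0 := by
  have hle : differenceIdeal f g ≤ TwoSidedIdeal.ker h.hom := by
    refine TwoSidedIdeal.span_le.2 ?_
    rintro _ ⟨x, rfl⟩
    rw [SetLike.mem_coe, TwoSidedIdeal.mem_ker, map_sub, sub_eq_zero]
    exact Rng.congr_elem w x
  exact (TwoSidedIdeal.mem_ker (f := h.hom)).1 (hle hy)

/-! ### Coequalizers of extensions over a fixed base -/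

section Coequalizers

variable {B : Rng.{u}} {X Y : Ext B} (f g : X ⟶ Y)

/-- A surjection is determined up to isomorphism by its kernel, so coequalizers can be recognised by
a kernel condition. This applies both to the constructed coequalizer and to its pullback. -/
theorem nonempty_isColimit_cofork {Q : Ext B} (c : Y ⟶ Q) (w : f ≫ c = g ≫ c)
    (hc : Function.Surjective c.left.hom)
    (hker : ∀ y, c.left.hom y = 0 → y ∈ differenceIdeal f.left g.left) :
    Nonempty (IsColimit (Cofork.ofπ c w)) := by
  have hd : ∀ s : Cofork f g, ∃ d : Q.left ⟶ s.pt.left, c.left ≫ d = s.π.left := fun s =>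
    Rng.exists_desc hc _ fun y hy => differenceIdeal_le_ker
      (congrArg (fun k => k.left) s.condition) (hker y hy)
  choose d hd using hd
  refine ⟨Cofork.IsColimit.mk _ (fun s => MorphismProperty.Over.homMk (d s) ?_) ?_ ?_⟩
  · refine Rng.elem_ext fun q => ?_
    obtain ⟨y, rfl⟩ := hc q
    have h₁ := Rng.congr_elem (hd s) y
    have h₂ := Rng.congr_elem (MorphismProperty.Over.w s.π) y
    have h₃ := Rng.congr_elem (MorphismProperty.Over.w c) y
    exact ((congrArg s.pt.hom.hom h₁).trans h₂).trans h₃.symm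
  · intro s
    exact MorphismProperty.Over.Hom.ext (hd s)
  · intro s m hm
    refine MorphismProperty.Over.Hom.ext (Rng.elem_ext fun q => ?_)
    obtain ⟨y, rfl⟩ := hc q
    exact (Rng.congr_elem (congrArg (fun k => k.left) hm) y).trans
      (Rng.congr_elem (hd s) y).symm

/-- The coequalizer of two morphisms of extensions. -/
def extCoequalizer : Ext B :=
  MorphismProperty.Over.mk ⊤
    (Rng.ofHom (A := (differenceIdeal f.left g.left).Quo) (B := B)
      ((differenceIdeal f.left g.left).quotLift Y.hom.hom fun _ ha =>
        differenceIdeal_le_ker ((MorphismProperty.Over.w f).trans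
          (MorphismProperty.Over.w g).symm) ha))
    ((Rng.isRegularEpi_iff_surjective _).2 fun b => by
      obtain ⟨y, hy⟩ := Y.hom_surjective b
      exact ⟨TwoSidedIdeal.quotMk _ y, hy⟩)

/-- The projection to the coequalizer of two morphisms of extensions. -/
def extCoequalizerπ : Y ⟶ extCoequalizer f g :=
  MorphismProperty.Over.homMk
    (Rng.ofHom (B := (differenceIdeal f.left g.left).Quo) (TwoSidedIdeal.quotMk _))

theorem extCoequalizer_condition : f ≫ extCoequalizerπ f g = g ≫ extCoequalizerπ f g := by
  refine MorphismProperty.Over.Hom.ext (Rng.elem_ext fun x => ?_)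
  refine sub_eq_zero.1 ((map_sub (TwoSidedIdeal.quotMk _) _ _).symm.trans ?_)
  exact (TwoSidedIdeal.quotMk_eq_zero _ _).2 (TwoSidedIdeal.subset_span ⟨x, rfl⟩)

/-- `extCoequalizerπ f g` is the coequalizer of `f` and `g`. -/
noncomputable def extCoequalizerIsColimit :
    IsColimit (Cofork.ofπ (extCoequalizerπ f g) (extCoequalizer_condition f g)) :=
  (nonempty_isColimit_cofork f g _ _ (TwoSidedIdeal.quotMk_surjective _)
    fun y hy => (TwoSidedIdeal.quotMk_eq_zero _ y).1 hy).some

end Coequalizers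

/-! ### Beck's conditions for pulling back along a surjection -/

section Pullback

variable {E B : Rng.{u}} (p : E ⟶ B)

/-- The projection of a pulled back extension. -/
noncomputable def extFst (X : Ext B) : ((extPullback p).obj X).left ⟶ X.left :=
  pullback.fst X.hom p

theorem isPullback_extFst (X : Ext B) :
    IsPullback (extFst p X) ((extPullback p).obj X).hom X.hom p :=
  IsPullback.of_hasPullback _ _

theorem extFst_naturality {X Y : Ext B} (h : X ⟶ Y) (z : ((extPullback p).obj X).left) :
    (extFst p Y).hom (((extPullback p).map h).left.hom z) = h.left.hom ((extFst p X).hom z) :=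
  Rng.congr_elem (pullback.lift_fst _ _ _) z

theorem ext_w_apply {X Y : Ext B} (h : X ⟶ Y) (z : X.left) :
    Y.hom.hom (h.left.hom z) = X.hom.hom z :=
  Rng.congr_elem (MorphismProperty.Over.w h) z

variable {p}

theorem extFst_surjective (hp : Function.Surjective p.hom) (X : Ext B) :
    Function.Surjective (extFst p X).hom := fun x => by
  obtain ⟨e, he⟩ := hp (X.hom.hom x)
  obtain ⟨z, hz, -⟩ := Rng.exists_of_isPullback (isPullback_extFst p X) he.symm
  exact ⟨z, hz⟩

/-- The projection to `Y` is surjective, so it maps the upper difference ideal onto an ideal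
containing the lower one. A preimage `t` found in this way has zero component in `E`, as does `z`,
so the two coincide. -/
theorem mem_differenceIdeal_map (hp : Function.Surjective p.hom) {X Y : Ext B} (f g : X ⟶ Y)
    {z : ((extPullback p).obj Y).left}
    (hz : (extFst p Y).hom z ∈ differenceIdeal f.left g.left)
    (hz₀ : ((extPullback p).obj Y).hom.hom z = 0) :
    z ∈ differenceIdeal ((extPullback p).map f).left ((extPullback p).map g).left := by
  have hle : differenceIdeal f.left g.left ≤
      (differenceIdeal ((extPullback p).map f).left ((extPullback p).map g).left).image
        (extFst p Y).hom (extFst_surjective hp Y) := by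
    refine TwoSidedIdeal.span_le.2 ?_
    rintro _ ⟨x, rfl⟩
    obtain ⟨t, rfl⟩ := extFst_surjective hp X x
    exact TwoSidedIdeal.mem_image.2 ⟨_, TwoSidedIdeal.subset_span ⟨t, rfl⟩, by
      rw [map_sub, extFst_naturality, extFst_naturality]⟩
  obtain ⟨t, ht, htz⟩ := TwoSidedIdeal.mem_image.1 (hle hz)
  have ht₀ : ((extPullback p).obj Y).hom.hom t = 0 :=
    differenceIdeal_le_ker ((MorphismProperty.Over.w ((extPullback p).map f)).trans
      (MorphismProperty.Over.w ((extPullback p).map g)).symm) ht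
  rwa [← Rng.ext_of_isPullback (isPullback_extFst p Y) htz (ht₀.trans hz₀.symm)]

theorem nonempty_isColimit_map_cofork (hp : Function.Surjective p.hom) {X Y : Ext B}
    (f g : X ⟶ Y) :
    Nonempty (IsColimit (Cofork.ofπ
      ((extPullback p).map (extCoequalizerπ f g))
      (by rw [← Functor.map_comp, extCoequalizer_condition, Functor.map_comp]) :
        Cofork ((extPullback p).map f) ((extPullback p).map g))) := by
  apply nonempty_isColimit_cofork
  · intro z
    obtain ⟨y, hy⟩ := TwoSidedIdeal.quotMk_surjective _ ((extFst p (extCoequalizer f g)).hom z)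
    have hw := Rng.congr_elem (isPullback_extFst p (extCoequalizer f g)).w z
    obtain ⟨t, h₁, h₂⟩ := Rng.exists_of_isPullback (isPullback_extFst p Y) (x := y)
      ((congrArg (extCoequalizer f g).hom.hom hy).trans hw)
    refine ⟨t, Rng.ext_of_isPullback (isPullback_extFst p _) ?_ ?_⟩
    · rw [extFst_naturality, h₁]
      exact hy
    · rw [ext_w_apply, h₂]
      rfl
  · intro z hz
    refine mem_differenceIdeal_map hp f g ?_ ?_
    · refine (TwoSidedIdeal.quotMk_eq_zero _ _).1 
        ((extFst_naturality p (extCoequalizerπ f g) z).symm.trans ?_)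
      exact (congrArg (extFst p (extCoequalizer f g)).hom hz).trans (map_zero _)
    · rw [← ext_w_apply ((extPullback p).map (extCoequalizerπ f g)), hz, map_zero]

theorem ext_isIso_of_bijective {X Y : Ext B} (h : X ⟶ Y) (hh : Function.Bijective h.left.hom) :
    IsIso h := by
  have := Rng.isIso_of_bijective _ hh
  exact (MorphismProperty.Over.isoMk (asIso h.left) (MorphismProperty.Over.w h)).isIso_hom

/-- An element `x` killed by `h` lies over zero in `B`, so `(x, 0)` is in the pullback and is killed
there. Surjectivity descends along the projections. -/
theorem reflectsIsomorphisms_extPullback (hp : Function.Surjective p.hom) :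
    (extPullback p).ReflectsIsomorphisms where
  reflects {X Y} h _ := by
    have hbij : Function.Bijective ((extPullback p).map h).left.hom :=
      Rng.bijective_of_isIso ((MorphismProperty.Over.forget _ _ _ ⋙ Over.forget _).map
        ((extPullback p).map h))
    refine ext_isIso_of_bijective h ⟨(injective_iff_map_eq_zero _).2 fun x hx => ?_, fun y => ?_⟩
    · obtain ⟨t, ht, ht₀⟩ := Rng.exists_of_isPullback (isPullback_extFst p X) (x := x) (y := 0)
        (by rw [← ext_w_apply h, hx, map_zero, map_zero])
      have : t = 0 := hbij.1 (Rng.ext_of_isPullback (isPullback_extFst p Y)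
        (by rw [extFst_naturality, ht, hx, map_zero, map_zero])
        (by rw [ext_w_apply, ht₀, map_zero, map_zero]))
      rw [← ht, this, map_zero]
    · obtain ⟨z, rfl⟩ := extFst_surjective hp Y y
      obtain ⟨t, rfl⟩ := hbij.2 z
      exact ⟨_, (extFst_naturality p h t).symm⟩

/-- Beck's theorem, with composition with `p` as left adjoint. Coequalizers of all parallel pairs
exist and are preserved, so the splitting hypothesis plays no role. -/
theorem isMonadicExtension {p : E ⟶ B} (hp : Function.Surjective p.hom) :
    galoisStructure.{u}.IsMonadicExtension p := by
  have hE : galoisStructure.{u}.ℰ p := (Rng.isRegularEpi_iff_surjective p).2 hp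
  refine ⟨hE, ⟨?_⟩⟩
  have : (extPullback p).ReflectsIsomorphisms := reflectsIsomorphisms_extPullback hp
  have : Monad.HasCoequalizerOfIsSplitPair (extPullback p) :=
    ⟨fun f g _ => ⟨⟨_, extCoequalizerIsColimit f g⟩⟩⟩
  have : Monad.PreservesColimitOfIsSplitPair (extPullback p) :=
    ⟨fun f g _ => preservesColimit_of_preserves_colimit_cocone (extCoequalizerIsColimit f g)
      ((isColimitMapCoconeCoforkEquiv (extPullback p) _).symm
        (nonempty_isColimit_map_cofork hp f g).some)⟩
  exact Monad.monadicOfHasPreservesGSplitCoequalizersOfReflectsIsomorphisms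
    (MorphismProperty.Over.mapPullbackAdj galoisStructure.{u}.ℰ ⊤ p hE trivial)

end Pullback

end RedCRng

/-! ### Normal extensions -/

namespace Rng

/-- Surjective homomorphisms whose kernel is central and reduced. -/
structure HasReducedCentralKernel {E B : Rng.{u}} (p : E ⟶ B) : Prop where
  surjective : Function.Surjective p.hom
  central : ∀ k ∈ kernelIdeal p, ∀ a : E, a * k = k * a
  reduced : ∀ k ∈ kernelIdeal p, ∀ n, ppow k n = 0 → k = 0

theorem mem_hopfNumerator {E B : Rng.{u}} {p : E ⟶ B} {a : E} :
    a ∈ hopfNumerator p ↔ p.hom a = 0 ∧ a ∈ E.radicalCommutator :=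
  (TwoSidedIdeal.mem_inf _).trans (and_congr_left' mem_kernelIdeal)

theorem map_mem_hopfNumerator {E E' B : Rng.{u}} {p : E ⟶ B} {p' : E' ⟶ B} {w : E ⟶ E'}
    (hw : p = w ≫ p') {a : E} (ha : a ∈ hopfNumerator p) : w.hom a ∈ hopfNumerator p' := by
  rw [mem_hopfNumerator] at ha ⊢
  exact ⟨(congr_elem hw a).symm.trans ha.1, map_mem_radicalCommutator w ha.2⟩

/-- The homomorphism between the rings `K ∧ √[E, E]` induced by a homomorphism over `B`. -/
def hopfNumeratorMap {E E' B : Rng.{u}} {p : E ⟶ B} {p' : E' ⟶ B} {w : E ⟶ E'}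
    (hw : p = w ≫ p') : hopfNumerator p →ₙ+* hopfNumerator p' where
  toFun a := ⟨w.hom a, map_mem_hopfNumerator hw a.2⟩
  map_zero' := Subtype.ext (map_zero w.hom)
  map_add' x y := Subtype.ext (map_add w.hom (x : E) (y : E))
  map_mul' x y := Subtype.ext (map_mul w.hom (x : E) (y : E))

namespace HasReducedCentralKernel

variable {E B : Rng.{u}} {p : E ⟶ B} (hp : HasReducedCentralKernel p)
include hp

theorem commutatorWith_eq_bot : (kernelIdeal p).commutatorWith = ⊥ :=
  TwoSidedIdeal.commutatorWith_eq_bot hp.central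

theorem eq_zero_of_mem_radicalWith {k : E} (hk : k ∈ (kernelIdeal p).radicalWith) : k = 0 := by
  obtain ⟨hK, n, hn⟩ := TwoSidedIdeal.mem_radicalWith.1 hk
  rw [hp.commutatorWith_eq_bot, TwoSidedIdeal.mem_bot] at hn
  exact hp.reduced _ hK n hn

theorem mul_commutator_eq_zero {d z : E} (hd : p.hom d = 0)
    (hz : z ∈ TwoSidedIdeal.commutatorIdeal E) : d * z = 0 := by
  have h := (TwoSidedIdeal.mem_commutatorAnnihilator.1
    (TwoSidedIdeal.commutatorIdeal_le_annihilator (K := kernelIdeal p) hz) d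
      (mem_kernelIdeal.2 hd)).1
  rwa [hp.commutatorWith_eq_bot, TwoSidedIdeal.mem_bot] at h

/-- Centrality gives `(d z) ^ m = d ^ m z ^ m`, which vanishes once `z ^ m` is in the commutator
ideal. Since `d z` lies in the reduced kernel, it is zero. -/
theorem mul_radicalCommutator_eq_zero {d z : E} (hd : p.hom d = 0)
    (hz : z ∈ E.radicalCommutator) : d * z = 0 := by
  obtain ⟨n, hn⟩ := mem_radicalCommutator.1 hz
  refine hp.reduced _ (TwoSidedIdeal.mul_mem_right _ _ _ (mem_kernelIdeal.2 hd)) n ?_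
  rw [ppow_mul_of_comm (hp.central d (mem_kernelIdeal.2 hd) z).symm]
  exact hp.mul_commutator_eq_zero
    (mem_kernelIdeal.1 (TwoSidedIdeal.ppow_mem (mem_kernelIdeal.2 hd) n)) hn

/-- Endomorphisms of `E` over `B` restrict to the identity on `K ∧ √[E, E]`. -/
theorem endomorphism_apply {e : E ⟶ E} (he : e ≫ p = p) {a : E} (ha : a ∈ hopfNumerator p) :
    e.hom a = a := by
  have hea := map_mem_hopfNumerator he.symm ha
  have hd : p.hom (e.hom a - a) = 0 := by
    rw [map_sub, (mem_hopfNumerator.1 hea).1, (mem_hopfNumerator.1 ha).1, sub_zero]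
  -- Index `1` in `ppow` means the square: both `e a` and `a` are annihilated by the difference `e a
  -- - a`.
  refine sub_eq_zero.1 (hp.reduced _ (mem_kernelIdeal.2 hd) 1 ?_)
  change (e.hom a - a) * (e.hom a - a) = 0
  rw [mul_sub, hp.mul_radicalCommutator_eq_zero hd (mem_hopfNumerator.1 hea).2,
    hp.mul_radicalCommutator_eq_zero hd (mem_hopfNumerator.1 ha).2, sub_zero]

end HasReducedCentralKernel

/-- Two extensions of `B` with reduced central kernels that map to each other have isomorphic
rings `K ∧ √[E, E]`. -/
theorem nonempty_iso_hopfNumerator {E E' B : Rng.{u}} {p : E ⟶ B} {p' : E' ⟶ B}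
    (hp : HasReducedCentralKernel p) (hp' : HasReducedCentralKernel p') {w : E ⟶ E'} {w' : E' ⟶ E}
    (hw : p = w ≫ p') (hw' : p' = w' ≫ p) :
    Nonempty (of (hopfNumerator p) ≅ of (hopfNumerator p')) := by
  refine ⟨isoOfBijective (hopfNumeratorMap hw) (Function.bijective_iff_has_inverse.2
    ⟨hopfNumeratorMap hw', fun a => Subtype.ext ?_, fun a => Subtype.ext ?_⟩)⟩
  · exact hp.endomorphism_apply (e := w ≫ w') (by rw [Category.assoc, ← hw', ← hw]) a.2
  · exact hp'.endomorphism_apply (e := w' ≫ w) (by rw [Category.assoc, ← hw, ← hw']) a.2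

/-! ### The extension attached to a free presentation -/

section Presentation

variable {P B : Rng.{u}} (f : P ⟶ B)

/-- The extension `P / √[K, P] ⟶ B`. -/
def presentationExtension : of (kernelIdeal f).radicalWith.Quo ⟶ B :=
  ofHom (B := B) ((kernelIdeal f).radicalWith.quotLift f.hom fun _ ha =>
    mem_kernelIdeal.1 (TwoSidedIdeal.radicalWith_le ha))

/-- The projection `P ⟶ P / √[K, P]`. -/
def presentationProjection : P ⟶ of (kernelIdeal f).radicalWith.Quo :=
  ofHom (A := P) (kernelIdeal f).radicalWith.quotMk

theorem presentationProjection_comp : presentationProjection f ≫ presentationExtension f = f :=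
  rfl

theorem presentationProjection_surjective : Function.Surjective (presentationProjection f).hom :=
  TwoSidedIdeal.quotMk_surjective _

theorem presentationProjection_eq_zero {a : P} :
    (presentationProjection f).hom a = 0 ↔ a ∈ (kernelIdeal f).radicalWith :=
  TwoSidedIdeal.quotMk_eq_zero _ a

variable {f}

theorem hasReducedCentralKernel_presentationExtension (hf : Function.Surjective f.hom) :
    HasReducedCentralKernel (presentationExtension f) where
  surjective b := by
    obtain ⟨a, ha⟩ := hf b
    exact ⟨(presentationProjection f).hom a, ha⟩
  central k hk a := by
    obtain ⟨k, rfl⟩ := presentationProjection_surjective f k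
    obtain ⟨a, rfl⟩ := presentationProjection_surjective f a
    have hk' : k ∈ kernelIdeal f := mem_kernelIdeal.2 (mem_kernelIdeal.1 hk)
    rw [← sub_eq_zero, ← map_mul, ← map_mul, ← map_sub, presentationProjection_eq_zero]
    have h := TwoSidedIdeal.commutatorWith_mem hk' a
    exact TwoSidedIdeal.mem_radicalWith.2 ⟨TwoSidedIdeal.commutatorWith_le _ h, 0, h⟩
  reduced k hk n hn := by
    obtain ⟨k, rfl⟩ := presentationProjection_surjective f k
    rw [← map_ppow, presentationProjection_eq_zero] at hn
    obtain ⟨m, hm⟩ := (TwoSidedIdeal.mem_radicalWith.1 hn).2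
    rw [RedCRng.ppow_ppow] at hm
    exact (presentationProjection_eq_zero f).2
      (TwoSidedIdeal.mem_radicalWith.2 ⟨mem_kernelIdeal.2 (mem_kernelIdeal.1 hk), _, hm⟩)

/-- Free rings are projective with respect to surjective homomorphisms. -/
theorem IsFree.exists_lift (hP : P.IsFree) {E : Rng.{u}} {p : E ⟶ B}
    (hp : Function.Surjective p.hom) (f : P ⟶ B) : ∃ g : P ⟶ E, g ≫ p = f := by
  obtain ⟨X, ι, h⟩ := hP
  obtain ⟨g, hg, -⟩ := h E fun x => Function.surjInv hp (f.hom (ι x))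
  refine ⟨g, (h B fun x => f.hom (ι x)).unique (fun x => ?_) fun _ => rfl⟩
  exact (congrArg p.hom (hg x)).trans (Function.surjInv_eq hp _)

/-- A lift `g` of `f` to `E` sends `K` into a central ideal, so it kills `[K, P]`; as that ideal is
reduced, `g` also kills `√[K, P]` and descends to the quotient. -/
theorem exists_presentationExtension_factor (hP : P.IsFree) {E : Rng.{u}} {p : E ⟶ B}
    (hp : HasReducedCentralKernel p) : ∃ w, presentationExtension f = w ≫ p := by
  obtain ⟨g, hg⟩ := hP.exists_lift hp.surjective f
  have hK : ∀ k ∈ kernelIdeal f, g.hom k ∈ kernelIdeal p := fun k hk =>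
    mem_kernelIdeal.2 ((congr_elem hg k).trans (mem_kernelIdeal.1 hk))
  have hker : ∀ a ∈ (kernelIdeal f).radicalWith, g.hom a = 0 := fun a ha => by
    obtain ⟨ha, n, hn⟩ := TwoSidedIdeal.mem_radicalWith.1 ha
    have hle : (kernelIdeal f).commutatorWith ≤ TwoSidedIdeal.ker g.hom := by
      refine TwoSidedIdeal.span_le.2 ?_
      rintro _ ⟨k, hk, a, rfl⟩
      rw [SetLike.mem_coe, TwoSidedIdeal.mem_ker, map_sub, map_mul, map_mul,
        hp.central _ (hK k hk), sub_self]
    refine hp.reduced _ (hK a ha) n ?_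
    rw [← map_ppow]
    exact (TwoSidedIdeal.mem_ker (f := g.hom)).1 (hle hn)
  refine ⟨ofHom (B := E) ((kernelIdeal f).radicalWith.quotLift g.hom hker), ?_⟩
  refine elem_ext fun x => ?_
  obtain ⟨a, rfl⟩ := presentationProjection_surjective f x
  exact (congr_elem hg a).symm

theorem nonempty_iso_hopfQuotient :
    Nonempty (of (hopfNumerator (presentationExtension f)) ≅ hopfQuotient f) := by
  let q := hopfNumeratorMap (presentationProjection_comp f).symm
  have hq : ∀ a, q a = 0 ↔ a ∈ hopfDenominator f := fun a => by
    refine (Subtype.ext_iff.trans (presentationProjection_eq_zero f)).trans ?_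
    exact ((TwoSidedIdeal.mem_comap (hopfInclusion f)).trans
      TwoSidedIdeal.mem_radical_commutatorIn).symm
  have hs : Function.Surjective q := by
    rintro ⟨y, hy⟩
    obtain ⟨a, rfl⟩ := presentationProjection_surjective f y
    obtain ⟨ha, hr⟩ := mem_hopfNumerator.1 hy
    obtain ⟨n, hn⟩ := mem_radicalCommutator.1 hr
    rw [← map_ppow] at hn
    obtain ⟨z, hz, hza⟩ := TwoSidedIdeal.exists_mem_commutatorIdeal
      (presentationProjection_surjective f) hn
    refine ⟨⟨a, mem_hopfNumerator.2 ⟨ha, mem_radicalCommutator_of_ppow (n := n) ?_⟩⟩, rfl⟩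
    -- The power of `a` agrees with the commutator element `z` up to `√[K, P]`, which is contained
    -- in `√[P, P]`. Hence the power, and then `a` itself, lies in `√[P, P]`.
    have hsub : ppow a n - z ∈ P.radicalCommutator := by
      refine radicalWith_le_radicalCommutator (kernelIdeal f) ?_
      rw [← presentationProjection_eq_zero, map_sub, hza, sub_self]
    have h := AddMemClass.add_mem hsub (mem_radicalCommutator.2 ⟨0, hz⟩)
    rwa [sub_add_cancel] at h
  let q' := (hopfDenominator f).quotLift q fun a ha => (hq a).2 ha
  refine ⟨(isoOfBijective q' ⟨(injective_iff_map_eq_zero q').2 fun x hx => ?_, fun y => ?_⟩).symm⟩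
  · obtain ⟨a, rfl⟩ := TwoSidedIdeal.quotMk_surjective _ x
    exact (TwoSidedIdeal.quotMk_eq_zero _ a).2 ((hq a).1 hx)
  · obtain ⟨a, rfl⟩ := hs y
    exact ⟨TwoSidedIdeal.quotMk _ a, rfl⟩

end Presentation

end Rng

/-! ### Kernel pairs and the characterisation of normal extensions -/

namespace RedCRng

open Rng

variable {E B R : Rng.{u}} {p : E ⟶ B} {π₁ π₂ : R ⟶ E}

theorem exists_diagonal (h : IsPullback π₁ π₂ p p) :
    ∃ δ : E ⟶ R, ∀ a, π₁.hom (δ.hom a) = a ∧ π₂.hom (δ.hom a) = a :=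
  ⟨h.lift (𝟙 E) (𝟙 E) rfl, fun a => ⟨congr_elem (h.lift_fst _ _ _) a,
    congr_elem (h.lift_snd _ _ _) a⟩⟩

/-- The kernel of the unit at the kernel pair, restricted to the kernel of the first projection,
is `√[K, E]`. -/
theorem unit_kernelPair_eq_zero_iff (h : IsPullback π₁ π₂ p p) {r : R} (hr : π₁.hom r = 0) :
    (unit R).hom r = 0 ↔ π₂.hom r ∈ (kernelIdeal p).radicalWith := by
  have hK : π₂.hom r ∈ kernelIdeal p :=
    mem_kernelIdeal.2 ((congr_elem h.w r).symm.trans ((congrArg p.hom hr).trans (map_zero _)))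
  rw [unit_eq_zero_iff, mem_radicalCommutator, TwoSidedIdeal.mem_radicalWith, and_iff_right hK]
  refine exists_congr fun n => ?_
  have h₀ : ppow (0 : E) n = 0 :=
    (TwoSidedIdeal.mem_bot _).1 (TwoSidedIdeal.ppow_mem (TwoSidedIdeal.zero_mem ⊥) n)
  rw [← exists_mem_commutatorIdeal_iff h]
  constructor
  · intro hn
    exact ⟨_, hn, by rw [map_ppow, hr, h₀], map_ppow _ _ _⟩
  · rintro ⟨s, hs, hs₁, hs₂⟩
    rwa [← ext_of_isPullback h (z := s) (z' := ppow r n)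
      (by rw [hs₁, map_ppow, hr, h₀]) (by rw [hs₂, map_ppow])]

/-- Uniqueness in the pullback is the vanishing of `√[K, E]`. For existence, a representative `r`
with the wrong first projection is corrected by the diagonal of `π₁ r - a`, which the unit kills. -/
theorem isTrivialExtension_fst (hp : HasReducedCentralKernel p) (h : IsPullback π₁ π₂ p p) :
    galoisStructure.{u}.IsTrivialExtension π₁ := by
  obtain ⟨δ, hδ⟩ := exists_diagonal h
  refine ⟨(isRegularEpi_iff_surjective π₁).2 fun a => ⟨δ.hom a, (hδ a).1⟩, ?_⟩
  refine isPullback_of_forall ((reflectorAdjunction toRng.{u}).unit.naturality π₁).symm ?_ ?_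
  · intro r hr hr₁
    have hr₂ := (unit_kernelPair_eq_zero_iff h hr₁).1 hr
    exact ext_of_isPullback h (hr₁.trans (map_zero _).symm)
      ((hp.eq_zero_of_mem_radicalWith hr₂).trans (map_zero _).symm)
  · intro x a hxa
    obtain ⟨r, rfl⟩ : ∃ r : R, (unit R).hom r = x := unit_surjective R x
    have hra : π₁.hom r - a ∈ E.radicalCommutator := by
      rw [← unit_eq_zero_iff, map_sub, sub_eq_zero]
      exact (map_unit π₁ r).symm.trans hxa
    refine ⟨r - δ.hom (π₁.hom r - a), ?_, ?_⟩
    · refine (map_sub (unit R).hom _ _).trans ?_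
      rw [unit_eq_zero_iff.2 (map_mem_radicalCommutator δ hra), sub_zero]
    · rw [map_sub, (hδ _).1, sub_sub_cancel]

/-- Normal extensions are the surjective homomorphisms with central and reduced kernel. -/
theorem isNormalExtension_iff :
    galoisStructure.{u}.IsNormalExtension p ↔ HasReducedCentralKernel p := by
  constructor
  · rintro ⟨hp, h⟩
    have hpb := isPullback_fibreProduct p p
    have htriv := (h _ _ _ hpb).2
    -- Triviality of the first projection forces `√[K, E] = 0`. This contains both `[K, E]` and the
    -- nilpotents of `K`, which gives centrality and reducedness at once.
    have key : ∀ k ∈ (kernelIdeal p).radicalWith, k = 0 := by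
      intro k hk
      have hk₀ : p.hom k = 0 := mem_kernelIdeal.1 (TwoSidedIdeal.radicalWith_le hk)
      obtain ⟨r, hr₁, hr₂⟩ := exists_of_isPullback hpb (x := 0) (y := k)
        ((map_zero _).trans hk₀.symm)
      have hr : r = 0 := ext_of_isPullback htriv
        (((unit_kernelPair_eq_zero_iff hpb hr₁).2 (hr₂ ▸ hk)).trans (map_zero _).symm)
        (hr₁.trans (map_zero _).symm)
      rw [← hr₂, hr, map_zero]
    refine ⟨(isRegularEpi_iff_surjective p).1 hp.1, fun k hk a => ?_, fun k hk n hn => ?_⟩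
    · have hc := TwoSidedIdeal.commutatorWith_mem hk a
      exact sub_eq_zero.1 (key _ (TwoSidedIdeal.mem_radicalWith.2
        ⟨TwoSidedIdeal.commutatorWith_le _ hc, 0, hc⟩))
    · exact key k (TwoSidedIdeal.mem_radicalWith.2
        ⟨hk, n, by rw [hn]; exact TwoSidedIdeal.zero_mem _⟩)
  · intro hp
    exact ⟨isMonadicExtension hp.surjective, fun _ _ _ h => isTrivialExtension_fst hp h⟩

theorem isWeaklyUniversal_presentationExtension {P : Rng.{u}} (hP : P.IsFree) {f : P ⟶ B}
    (hf : Function.Surjective f.hom) :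
    galoisStructure.{u}.IsWeaklyUniversalNormalExtension (presentationExtension f) :=
  ⟨isNormalExtension_iff.2 (hasReducedCentralKernel_presentationExtension hf), fun _ _ hp' =>
    exists_presentationExtension_factor hP (isNormalExtension_iff.1 hp')⟩

/-! ### The Galois group -/

section JointKernel

variable {X Y Z : RedCRng.{u}} (a : X ⟶ Y) (b : X ⟶ Z)

/-- The intersection of the kernels of two homomorphisms. -/
def jointKernelIdeal : TwoSidedIdeal (toRng.obj X) :=
  kernelIdeal (toRng.map a) ⊓ kernelIdeal (toRng.map b)

theorem mem_jointKernelIdeal {x : toRng.obj X} : x ∈ jointKernelIdeal a b ↔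
    (toRng.map a).hom x = 0 ∧ (toRng.map b).hom x = 0 :=
  (TwoSidedIdeal.mem_inf _).trans (and_congr mem_kernelIdeal mem_kernelIdeal)

/-- The intersection of the kernels of two homomorphisms, as a reduced ring. -/
def jointKernel : RedCRng.{u} :=
  ⟨⟨Rng.of (jointKernelIdeal a b), fun x y => Subtype.ext (X.obj.property x.1 y.1)⟩,
    fun x n hx => Subtype.ext (X.property x.1 n
      ((TwoSidedIdeal.coe_ppow (K := jointKernelIdeal a b) x n).symm.trans
        (congrArg Subtype.val hx)))⟩

/-- The inclusion of the intersection of two kernels. -/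
def jointKernelι : jointKernel a b ⟶ X :=
  ObjectProperty.homMk (ObjectProperty.homMk ⟨(jointKernelIdeal a b).incl⟩)

open ZeroObject

theorem hom_apply_eq_zero_of_factor {X Y : RedCRng.{u}} {g : X ⟶ Y} {s : X ⟶ 0} {t : 0 ⟶ Y}
    (h : g = s ≫ t) (x : toRng.obj X) : (toRng.map g).hom x = 0 := by
  subst h
  have hs : (toRng.map s).hom x = 0 := Subsingleton.elim (α := toRng.obj (0 : RedCRng.{u})) _ _
  exact (congrArg (toRng.map t).hom hs).trans (map_zero _)

theorem isPullback_jointKernel :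
    IsPullback (jointKernelι a b) ((isZero_zero RedCRng.{u}).from_ _) (prod.lift a b)
      ((isZero_zero RedCRng.{u}).to_ (Y ⨯ Z)) where
  w := by
    have h : ∀ {T : RedCRng.{u}} (c : X ⟶ T) (t : 0 ⟶ T),
        (∀ x ∈ jointKernelIdeal a b, (toRng.map c).hom x = 0) →
        jointKernelι a b ≫ c = (isZero_zero RedCRng.{u}).from_ _ ≫ t := fun c t hc => by
      refine toRng.map_injective (elem_ext fun x => ?_)
      exact (hc _ x.2).trans (hom_apply_eq_zero_of_factor rfl x).symm
    apply Limits.prod.hom_ext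
    · rw [Category.assoc, Category.assoc, prod.lift_fst]
      exact h _ _ fun x hx => ((mem_jointKernelIdeal a b).1 hx).1
    · rw [Category.assoc, Category.assoc, prod.lift_snd]
      exact h _ _ fun x hx => ((mem_jointKernelIdeal a b).1 hx).2
  isLimit' := by
    have hs : ∀ (s : PullbackCone (prod.lift a b) ((isZero_zero RedCRng.{u}).to_ (Y ⨯ Z)))
        (x : toRng.obj s.pt), (toRng.map s.fst).hom x ∈ jointKernelIdeal a b := fun s x => by
      have h₁ : s.fst ≫ a = s.snd ≫ (isZero_zero RedCRng.{u}).to_ (Y ⨯ Z) ≫ prod.fst := by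
        rw [← reassoc_of% s.condition, prod.lift_fst]
      have h₂ : s.fst ≫ b = s.snd ≫ (isZero_zero RedCRng.{u}).to_ (Y ⨯ Z) ≫ prod.snd := by
        rw [← reassoc_of% s.condition, prod.lift_snd]
      exact (mem_jointKernelIdeal a b).2
        ⟨hom_apply_eq_zero_of_factor h₁ x, hom_apply_eq_zero_of_factor h₂ x⟩
    exact ⟨PullbackCone.IsLimit.mk _
      (fun s => ObjectProperty.homMk (ObjectProperty.homMk (Rng.Hom.mk
        (B := Rng.of (jointKernelIdeal a b))
        { toFun := fun x => ⟨(toRng.map s.fst).hom x, hs s x⟩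
          map_zero' := Subtype.ext (map_zero _)
          map_add' := fun x y => Subtype.ext (map_add _ x y)
          map_mul' := fun x y => Subtype.ext (map_mul _ x y) })))
      (fun _ => rfl) (fun _ => (isZero_zero RedCRng.{u}).eq_of_tgt _ _)
      (fun s m hm _ => toRng.map_injective (elem_ext fun x =>
        Subtype.ext (congr_elem (congrArg toRng.map hm) x)))⟩

end JointKernel

/-- Both rings are compared as subrings of the reflection of `R`. If the class of `r` is in both
kernels, then `π₁ r` is in `√[E, E]`, so subtracting its diagonal does not change the class and
leaves `(0, π₂ r - π₁ r)`. The unit is injective on elements `(0, k)` with `k` in `K`, because `√[K,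
E] = 0`. -/
theorem nonempty_iso_jointKernel (hp : HasReducedCentralKernel p) (h : IsPullback π₁ π₂ p p) :
    Nonempty (toRng.obj (jointKernel ((reflector toRng).map π₁) ((reflector toRng).map π₂)) ≅
      Rng.of (hopfNumerator p)) := by
  obtain ⟨δ, hδ⟩ := exists_diagonal h
  let ι : Rng.of (hopfNumerator p) ⟶ E := ⟨(hopfNumerator p).incl⟩
  let z : Rng.of (hopfNumerator p) ⟶ E := ⟨0⟩
  have w : z ≫ p = ι ≫ p := elem_ext fun a =>
    (map_zero p.hom).trans (mem_hopfNumerator.1 a.2).1.symm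
  let j : Rng.of (hopfNumerator p) ⟶ R := h.lift z ι w
  have hj₁ : ∀ a : hopfNumerator p, π₁.hom (j.hom a) = 0 := congr_elem (h.lift_fst z ι w)
  have hj₂ : ∀ a : hopfNumerator p, π₂.hom (j.hom a) = a := congr_elem (h.lift_snd z ι w)
  refine nonempty_iso_of_range_eq (f := (jointKernelIdeal ((reflector toRng).map π₁)
    ((reflector toRng).map π₂)).incl) (g := (j ≫ unit R).hom) Subtype.val_injective
    ((injective_iff_map_eq_zero _).2 fun a ha => Subtype.ext ?_) (Set.Subset.antisymm ?_ ?_)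
  · have ha' := (unit_kernelPair_eq_zero_iff h (hj₁ a)).1 ha
    rw [hj₂] at ha'
    exact hp.eq_zero_of_mem_radicalWith ha'
  · rintro _ ⟨⟨x, hx⟩, rfl⟩
    obtain ⟨r, rfl⟩ : ∃ r : R, (unit R).hom r = x := unit_surjective R x
    obtain ⟨h₁, h₂⟩ := (mem_jointKernelIdeal _ _).1 hx
    rw [map_unit, unit_eq_zero_iff] at h₁ h₂
    have hr : π₂.hom r - π₁.hom r ∈ hopfNumerator p := by
      refine mem_hopfNumerator.2 ⟨?_, TwoSidedIdeal.sub_mem _ h₂ h₁⟩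
      rw [map_sub, sub_eq_zero]
      exact (congr_elem h.w r).symm
    have hjr : j.hom ⟨_, hr⟩ = r - δ.hom (π₁.hom r) := by
      refine ext_of_isPullback h ?_ ?_
      · rw [hj₁, map_sub, (hδ _).1, sub_self]
      · rw [hj₂, map_sub, (hδ _).2]
    refine ⟨⟨_, hr⟩, ?_⟩
    refine (congrArg (unit R).hom hjr).trans ((map_sub (unit R).hom _ _).trans ?_)
    rw [unit_eq_zero_iff.2 (map_mem_radicalCommutator δ h₁), sub_zero]
    rfl
  · rintro _ ⟨a, rfl⟩
    refine ⟨⟨(unit R).hom (j.hom a), (mem_jointKernelIdeal _ _).2 ⟨?_, ?_⟩⟩, rfl⟩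
    · rw [map_unit, hj₁, map_zero]
    · rw [map_unit, hj₂, unit_eq_zero_iff]
      exact (mem_hopfNumerator.1 a.2).2

/-- The Galois group of a normal extension `p : E ⟶ B` with kernel `K` is `K ∧ √[E, E]`. -/
theorem nonempty_galoisGroup_iso (hp : HasReducedCentralKernel p) :
    Nonempty (toRng.obj (galoisStructure.{u}.galoisGroup p) ≅ Rng.of (hopfNumerator p)) :=
  (nonempty_iso_jointKernel hp (IsPullback.of_hasPullback p p)).map fun e =>
    toRng.mapIso (isPullback_jointKernel _ _).isoPullback.symm ≪≫ e

end RedCRng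

theorem mainTheorem9 :
    -- the composite reflection is admissible and `F : CRng ⥤ RedCRng` is protoadditive
    RedCRng.galoisStructure.{u}.Admissible ∧
    Protoadditive (reflector RedCRng.inclusion.{u}) ∧
    -- the homological closure of an ideal of a commutative ring is its radical
    (∀ (A : CRng.{u}) (J : TwoSidedIdeal A.obj),
      CRng.closure RedCRng.inclusion.{u} A J = J.radical (A.commutator_mem J)) ∧
    -- free presentations `K ⟶ P ⟶ B`, with `K` the kernel of `f`
    ∀ (B P : Rng.{u}) (f : P ⟶ B), P.IsFree → IsRegularEpi f →
      -- the relative commutators `[P, P]` and `[K, P]`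
      Rng.relativeCommutator CRng.inclusion.{u} ((isZero_zero Rng.{u}).from_ P) =
        (TwoSidedIdeal.commutatorIdeal P : Set P) ∧
      Rng.relativeCommutator CRng.inclusion.{u} f =
        ((Rng.kernelIdeal f).commutatorWith : Set P) ∧
      -- their closures, in `P` and in `K` respectively, are radicals
      Rng.closure RedCRng.toRng.{u} (TwoSidedIdeal.commutatorIdeal P) = P.radicalCommutator ∧
      Rng.closure RedCRng.toRng.{u} (Rng.kernelIdeal f).commutatorIn =
        Rng.kernelRadicalCommutator f ∧
      -- `√[K, P]` is contained in `K ∧ √[P, P]`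
      (∀ k ∈ Rng.kernelRadicalCommutator f, (k : P) ∈ Rng.hopfNumerator f) ∧
      -- the fundamental group: the Galois group of any weakly universal normal extension of `B`
      (∃ (E : Rng.{u}) (p : E ⟶ B),
        RedCRng.galoisStructure.{u}.IsWeaklyUniversalNormalExtension p) ∧
      ∀ (E : Rng.{u}) (p : E ⟶ B),
        RedCRng.galoisStructure.{u}.IsWeaklyUniversalNormalExtension p →
        Nonempty (RedCRng.toRng.obj (RedCRng.galoisStructure.{u}.galoisGroup p) ≅
          Rng.hopfQuotient f) := by
  refine ⟨RedCRng.admissible, RedCRng.protoadditive, RedCRng.closure_inclusion,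
    fun B P f hP hf => ?_⟩
  rw [Rng.isRegularEpi_iff_surjective] at hf
  have huniv := RedCRng.isWeaklyUniversal_presentationExtension hP hf
  refine ⟨Rng.relativeCommutator_from_zero P, Rng.relativeCommutator_eq f,
    RedCRng.closure_toRng _ _, RedCRng.closure_toRng _ _, fun k hk => ?_, ⟨_, _, huniv⟩,
    fun E p hp => ?_⟩
  · exact TwoSidedIdeal.mem_inf _ |>.2 ⟨k.2, Rng.radicalWith_le_radicalCommutator _
      (TwoSidedIdeal.mem_radical_commutatorIn.1 hk)⟩
  -- Two weakly universal normal extensions map to each other over `B`, so rigidity reduces the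
  -- claim to the extension built from the presentation.
  · obtain ⟨w, hw⟩ := hp.2 _ _ huniv.1
    obtain ⟨w', hw'⟩ := huniv.2 _ _ hp.1
    have hp' := RedCRng.isNormalExtension_iff.1 hp.1
    obtain ⟨e₁⟩ := RedCRng.nonempty_galoisGroup_iso hp'
    obtain ⟨e₂⟩ := Rng.nonempty_iso_hopfNumerator hp'
      (RedCRng.isNormalExtension_iff.1 huniv.1) hw hw'
    obtain ⟨e₃⟩ := Rng.nonempty_iso_hopfQuotient (f := f)
    exact ⟨e₁ ≪≫ e₂ ≪≫ e₃⟩
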